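/- For a polynomial $f\in\mathbb C[z]$ and $r>0$ write $\|f\|_r=\left(\frac1{2\pi}\int_0^{2\pi}|f(e^{i\theta})|^r\,d\theta\right)^{1/r}$. An additive character polynomial over a finite field $\mathbb F_q$ is a polynomial $$f(z)=\sum_{j\in S}\psi(\alpha(j+t))z^j,$$ where $\psi\colon\mathbb F_q\to\mathbb C$ is a nontrivial additive character, the support $S$ is of the form $\{0,1,\ldots,s-1\}$, the translation $t$ is an integer, and the arrangement $\alpha$ is a group epimorphism from $\mathbb Z$ onto $\mathbb F_q^*$. A family $\{f_\iota\}_{\iota\in I}$ of additive character polynomials, with $f_\iota$ over the field $\mathbb F_{q_\iota}$ and with support $S_\iota$, is size-stable with limiting size $\sigma$ if $\{q_\iota:\iota\in I\}$ is infinite and $|S_\iota|/(q_\iota-1)$ tends to the positive real number $\sigma$ as $q_\iota\to\infty$. For real $x\neq0$ and $y$ put $$\Omega(x,y)=\sum_{n\in\mathbb Z}\max(0,1-|xn-y|)^2.$$ Theorem. Let $\{f_\iota\}_{\iota\in I}$ be a size-stable family, with limiting size $\sigma$, of additive character polynomials over fields $\{\mathbb F_{q_\iota}\}_{\iota\in I}$.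 (i) As $q_\iota\to\infty$, we have $$\frac{\|f_\iota\|_4^4}{\|f_\iota\|_2^4}\to-\frac23\sigma+2\,\Omega\left(\frac1\sigma,0\right).$$ (ii) The polynomial $x^3-12x+12$ has a unique root in the interval $\left(1,1+\frac9{64}\right)$, and the limit in (i) is globally minimized if and only if $\sigma$ is this root. Here globally minimized may be read in either of two ways: the function $x\mapsto-\frac23x+2\,\Omega(\frac1x,0)$ on the positive real numbers attains its minimum at $x=\sigma$; or the limit in (i) is at most the limit of $\|g_\kappa\|_4^4/\|g_\kappa\|_2^4$ for every size-stable family $\{g_\kappa\}$ of additive character polynomials. The equivalence holds for both readings. -/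

import Mathlib

open Filter Topology

universe u v

/-- The normalized `L^r` norm of a polynomial on the complex unit circle,
`((1 / 2π) ∫ θ in 0..2π, |f (exp (iθ))| ^ r) ^ (1 / r)`. -/
noncomputable def lrNorm (r : ℝ) (f : Polynomial ℂ) : ℝ :=
  ((1 / (2 * Real.pi)) *
    ∫ θ in (0 : ℝ)..(2 * Real.pi),
      ‖f.eval (Complex.exp (Complex.I * (θ : ℂ)))‖ ^ r) ^ (1 / r)

/-- The data of an additive character polynomial over the finite field `F`: a nontrivial additive
character, a support `{0, 1, …, size - 1}`, a translation, and an arrangement, i.e. a group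
epimorphism from the additive group of integers to the multiplicative group of `F`. -/
structure AddCharPoly (F : Type v) [Field F] [Finite F] where
  char : AddChar F ℂ
  char_nontrivial : char ≠ 1
  size : ℕ
  translation : ℤ
  arrangement : Multiplicative ℤ →* Fˣ
  arrangement_surjective : Function.Surjective arrangement

namespace AddCharPoly

variable {F : Type v} [Field F] [Finite F]

/-- The support `{0, 1, …, size - 1}`. -/
def support (f : AddCharPoly F) : Finset ℕ := Finset.range f.size

/-- The polynomial `∑ j ∈ S, ψ (α (j + t)) z ^ j`. -/
noncomputable def toPolynomial (f : AddCharPoly F) : Polynomial ℂ :=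
  ∑ j ∈ f.support,
    Polynomial.C (f.char (f.arrangement (Multiplicative.ofAdd ((j : ℤ) + f.translation)) : F)) *
      Polynomial.X ^ j

/-- The ratio `‖f‖₄ ^ 4 / ‖f‖₂ ^ 4`. -/
noncomputable def normRatio (f : AddCharPoly F) : ℝ :=
  lrNorm 4 f.toPolynomial ^ 4 / lrNorm 2 f.toPolynomial ^ 4

end AddCharPoly

/-- The filter on the index set of a family of fields describing `q_i → ∞`, where `q_i` is the
order of the `i`-th field. -/
noncomputable def orderAtTop {I : Type u} (F : I → Type v) : Filter I :=
  comap (fun i => Nat.card (F i)) atTop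

/-- The family `f` is size-stable with limiting size `σ`: the set of orders `q_i` of the fields is
infinite, and `|S_i| / (q_i - 1)` tends to the positive real number `σ` as `q_i → ∞`. -/
def IsSizeStable {I : Type u} {F : I → Type v} [∀ i, Field (F i)] [∀ i, Finite (F i)]
    (f : ∀ i, AddCharPoly (F i)) (σ : ℝ) : Prop :=
  (Set.range fun i => Nat.card (F i)).Infinite ∧ 0 < σ ∧
    Tendsto (fun i => ((f i).support.card : ℝ) / ((Nat.card (F i) : ℝ) - 1))
      (orderAtTop F) (𝓝 σ)

/-- `Ω(x, y) = ∑_{n ∈ ℤ} max (0, 1 - |x n - y|) ^ 2`, used for `x ≠ 0`, where all but finitely many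
terms vanish. -/
noncomputable def Omega (x y : ℝ) : ℝ :=
  ∑' n : ℤ, (max 0 (1 - |x * (n : ℝ) - y|)) ^ 2

/-- The limiting value `-(2/3) σ + 2 Ω(1/σ, 0)` as a function of the limiting size. -/
noncomputable def limitRatio (σ : ℝ) : ℝ :=
  -(2 / 3) * σ + 2 * Omega (1 / σ) 0

/-!
Let `q` be the order of the field, `N = q - 1`, `g` the generator given by the arrangement and `s`
the size. Absorbing the translation into the character `ψ`, the coefficients are `ψ (g ^ j)`, so
`‖f‖₂ ^ 2 = s` and `‖f‖₄ ^ 4` is the sum of `ψ (g ^ a + g ^ b - g ^ c - g ^ d)` over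
`a, b, c, d < s` with `a + b = c + d`. Such quadruples lie on the surface `x y = z v` in `(Fˣ) ^ 4`.
The terms with `a ≡ c` or `b ≡ c` modulo `N` are `1`; they number about
`2 ∑ n, max 0 (s - |n| N) ^ 2`, which produces `2 Ω (1 / σ, 0)`. The other terms have average about
`-1 / N`, and since there are about `2 s ^ 3 / 3` quadruples they produce `-(2 / 3) σ`.

To control the deviation from this average, `offDiagKernel` subtracts both main terms from
`ψ (x + y - z - v)`. With `x = p z`, `y = r z`, `v = p r z` one has
`x + y - z - v = -(1 - p) (1 - r) z`, so each sum of the kernel against four multiplicative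
characters is either elementary or a Gauss sum times two Jacobi sums, and is at most `3 q ^ (3 / 2)`
(`norm_sum_mulChar_offDiagKernel_le`). The passage from complete character sums to exponents below
`s` costs a factor `2 s / N + 1 + log N` per variable by the `L¹` bound for the Dirichlet kernel
(`norm_sum_pow_mul_le`). That bound is uniform in a twist by `exp (i θ (a + b - c - d))`, and
integration over `θ` isolates `a + b = c + d`. The error is therefore
`O (q ^ (3 / 2) (log q) ^ 4) = o (s ^ 2)`.

For the minimization, `limitRatio x` is `2 - 2 x / 3` on `(0, 1]`, is at least `2 x / 3` everywhere
by comparing `Ω` with an integral, and is `-2 x / 3 + 6 - 8 / x + 4 / x ^ 2` on `[1, 2]`, where its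
derivative vanishes exactly when `x ^ 3 - 12 x + 12 = 0`. Any family can be resized to any limiting
size, so the two readings of minimality agree.
-/

/-! ### Gauss and Jacobi sums -/

theorem norm_gaussSum_eq_sqrt {F : Type v} [Field F] [Fintype F] {χ : MulChar F ℂ} (hχ : χ ≠ 1)
    {ψ : AddChar F ℂ} (hψ : ψ ≠ 1) : ‖gaussSum χ ψ‖ = √(Fintype.card F) := by
  have h := gaussSum_mul_gaussSum_eq_card hχ (AddChar.IsPrimitive.of_ne_one hψ)
  rw [← star_gaussSum_eq, Complex.star_def, Complex.mul_conj, Complex.normSq_eq_norm_sq] at h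
  rw [eq_comm, Real.sqrt_eq_iff_mul_self_eq (by positivity) (by positivity), ← sq]
  exact_mod_cast h.symm

theorem MulChar.norm_apply_unit {F : Type v} [Field F] [Finite F] (χ : MulChar F ℂ) (x : Fˣ) :
    ‖χ x‖ = 1 := by
  have h : χ x * star (χ x) = 1 := by
    rw [MulChar.star_apply', MulChar.inv_apply_eq_inv']
    exact mul_inv_cancel₀ (x.isUnit.map χ).ne_zero
  rw [Complex.star_def, Complex.mul_conj, Complex.normSq_eq_norm_sq] at h
  have h' : ‖χ x‖ ^ 2 = 1 := by exact_mod_cast h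
  exact (pow_eq_one_iff_of_nonneg (norm_nonneg _) two_ne_zero).1 h'

theorem one_le_sqrt_card (F : Type v) [Field F] [Fintype F] : 1 ≤ √(Fintype.card F : ℝ) := by
  rw [Real.one_le_sqrt]
  exact_mod_cast Fintype.card_pos

/-- The bound includes the degenerate cases, in which the Jacobi sum has absolute value `1`. -/
theorem norm_jacobiSum_le {F : Type v} [Field F] [Fintype F] (φ : MulChar F ℂ) {χ : MulChar F ℂ}
    (hχ : χ ≠ 1) : ‖jacobiSum φ χ‖ ≤ √(Fintype.card F) := by
  classical
  by_cases hφ : φ = 1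
  · rw [hφ, jacobiSum_one_nontrivial hχ, norm_neg, norm_one]
    exact one_le_sqrt_card F
  by_cases hφχ : φ * χ = 1
  · obtain rfl : χ = φ⁻¹ := eq_inv_of_mul_eq_one_right hφχ
    rw [jacobiSum_nontrivial_inv hφ, norm_neg]
    have := MulChar.norm_apply_unit φ (-1)
    rw [Units.val_neg, Units.val_one] at this
    rw [this]
    exact one_le_sqrt_card F
  · obtain ⟨ψ, hψ⟩ : ∃ ψ : AddChar F ℂ, ψ ≠ 1 := by
      obtain ⟨ψ, hψ⟩ := AddChar.exists_apply_ne_zero.2 (one_ne_zero : (1 : F) ≠ 0)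
      exact ⟨ψ, fun h => hψ (by rw [h]; rfl)⟩
    have h := congrArg norm (jacobiSum_mul_nontrivial hφχ ψ)
    rw [norm_mul, norm_mul, norm_gaussSum_eq_sqrt hφχ hψ, norm_gaussSum_eq_sqrt hφ hψ,
      norm_gaussSum_eq_sqrt hχ hψ] at h
    exact (mul_left_cancel₀ (zero_lt_one.trans_le (one_le_sqrt_card F)).ne' h).le

theorem sum_units_mulChar_mul {F : Type v} [Field F] [Fintype F] [DecidableEq F] (χ : MulChar F ℂ)
    (f : F → ℂ) : ∑ x : Fˣ, χ x * f x = ∑ x : F, χ x * f x := by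
  refine Fintype.sum_of_injective (fun x : Fˣ => (x : F)) Units.val_injective _ _ ?_ fun _ => rfl
  intro x hx
  rw [MulChar.map_nonunit χ (fun h => hx ⟨h.unit, rfl⟩), zero_mul]

theorem sum_units_mulChar_eq_zero {F : Type v} [Field F] [Fintype F] [DecidableEq F]
    {χ : MulChar F ℂ} (hχ : χ ≠ 1) : ∑ x : Fˣ, χ x = 0 := by
  have := sum_units_mulChar_mul χ fun _ => 1
  simpa [MulChar.sum_eq_zero_of_ne_one hχ] using this

theorem sum_units_mulChar_mul_addChar {F : Type v} [Field F] [Fintype F] [DecidableEq F]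
    {χ : MulChar F ℂ} (hχ : χ ≠ 1) (ψ : AddChar F ℂ) (c : F) :
    ∑ z : Fˣ, χ z * ψ (c * z) = χ⁻¹ c * gaussSum χ ψ := by
  by_cases hc : c = 0
  · simp [hc, sum_units_mulChar_eq_zero hχ, MulChar.map_zero]
  · have h := gaussSum_mulShift χ ψ (Units.mk0 c hc)
    rw [Units.val_mk0] at h
    rw [← h, ← mul_assoc, MulChar.inv_apply_eq_inv',
      inv_mul_cancel₀ ((IsUnit.mk0 c hc).map χ).ne_zero, one_mul]
    exact sum_units_mulChar_mul χ fun z => ψ (c * z)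

theorem sum_units_addChar {F : Type v} [Field F] [Fintype F] [DecidableEq F]
    {ψ : AddChar F ℂ} (hψ : ψ ≠ 1) (c : F) :
    ∑ z : Fˣ, ψ (c * z) = (if c = 0 then (Fintype.card F : ℂ) else 0) - 1 := by
  have h := AddChar.sum_mulShift c (AddChar.IsPrimitive.of_ne_one hψ)
  have h2 : ∑ z : Fˣ, ψ (c * z) = ∑ x ∈ Finset.univ.erase (0 : F), ψ (x * c) := by
    refine Finset.sum_bij (fun x _ => (x : F)) (by simp) (fun _ _ _ _ h => Units.ext h) ?_ ?_
    · intro b hb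
      exact ⟨Units.mk0 b (Finset.ne_of_mem_erase hb), Finset.mem_univ _, rfl⟩
    · intro a _
      rw [mul_comm]
  rw [h2, eq_sub_iff_add_eq]
  rw [← Finset.sum_erase_add _ _ (Finset.mem_univ (0 : F)), zero_mul, AddChar.map_zero_eq_one] at h
  rw [h]
  split_ifs <;> simp

/-! ### Character sums of the off-diagonal kernel -/

/-- The values `ψ (x + y - z - v)` on the surface `x y = z v`, corrected by the indicators of the
two diagonals `x = z` and `y = z` and by the average `-1 / (q - 1)` that remains off the
diagonals. The kernel is extended by zero off the surface. -/
noncomputable def offDiagKernel {F : Type v} [Field F] [Fintype F] [DecidableEq F]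
    (ψ : AddChar F ℂ) (x y z v : Fˣ) : ℂ :=
  if x * y = z * v then
    ψ ((x : F) + y - z - v) - (if x = z then 1 else 0) - (if y = z then 1 else 0)
      + 1 / (Fintype.card Fˣ : ℂ)
  else 0

/-- The substitution `x = p z`, `y = r z`, `v = p r z` factors the argument of `ψ` as
`-(1 - p) (1 - r) z`. -/
theorem sum_mulChar_offDiagKernel {F : Type v} [Field F] [Fintype F] [DecidableEq F]
    (ψ : AddChar F ℂ) (χ₁ χ₂ χ₃ χ₄ : MulChar F ℂ) :
    ∑ x : Fˣ, χ₁ x * ∑ y : Fˣ, χ₂ y * ∑ z : Fˣ, χ₃ z * ∑ v : Fˣ, χ₄ v * offDiagKernel ψ x y z v =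
      ∑ p : Fˣ, ∑ r : Fˣ, (χ₁ * χ₄) p * (χ₂ * χ₄) r * ∑ z : Fˣ, (χ₁ * χ₂ * χ₃ * χ₄) z *
        (ψ (-((1 - (p : F)) * (1 - r)) * z) - (if p = 1 then 1 else 0) - (if r = 1 then 1 else 0)
          + 1 / (Fintype.card Fˣ : ℂ)) := by
  have hv : ∀ x y z : Fˣ, ∑ v : Fˣ, χ₄ v * offDiagKernel ψ x y z v =
      χ₄ (x * y * z⁻¹ : Fˣ) * offDiagKernel ψ x y z (x * y * z⁻¹) := by
    intro x y z
    refine Finset.sum_eq_single_of_mem _ (Finset.mem_univ _) fun v _ hv => ?_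
    rw [offDiagKernel, if_neg, mul_zero]
    intro h
    exact hv (by rw [h]; simp)
  simp only [hv, Finset.mul_sum]
  -- the surface `x y = z v` is parametrized by `x = p z`, `y = r z`, `v = p r z`
  calc _ = ∑ x : Fˣ, ∑ z : Fˣ, ∑ y : Fˣ, χ₁ x * (χ₂ y * (χ₃ z *
        (χ₄ (x * y * z⁻¹ : Fˣ) * offDiagKernel ψ x y z (x * y * z⁻¹)))) :=
        Finset.sum_congr rfl fun x _ => Finset.sum_comm
    _ = ∑ z : Fˣ, ∑ x : Fˣ, ∑ y : Fˣ, χ₁ x * (χ₂ y * (χ₃ z *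
        (χ₄ (x * y * z⁻¹ : Fˣ) * offDiagKernel ψ x y z (x * y * z⁻¹)))) := Finset.sum_comm
    _ = ∑ z : Fˣ, ∑ p : Fˣ, ∑ r : Fˣ, χ₁ (p * z : Fˣ) * (χ₂ (r * z : Fˣ) * (χ₃ z *
        (χ₄ ((p * z) * (r * z) * z⁻¹ : Fˣ) *
          offDiagKernel ψ (p * z) (r * z) z ((p * z) * (r * z) * z⁻¹)))) := by
        refine Finset.sum_congr rfl fun z _ => ?_
        rw [← Equiv.sum_comp (Equiv.mulRight z)]
        refine Finset.sum_congr rfl fun p _ => ?_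
        rw [← Equiv.sum_comp (Equiv.mulRight z)]
        rfl
    _ = ∑ p : Fˣ, ∑ z : Fˣ, ∑ r : Fˣ, χ₁ (p * z : Fˣ) * (χ₂ (r * z : Fˣ) * (χ₃ z *
        (χ₄ ((p * z) * (r * z) * z⁻¹ : Fˣ) *
          offDiagKernel ψ (p * z) (r * z) z ((p * z) * (r * z) * z⁻¹)))) := Finset.sum_comm
    _ = ∑ p : Fˣ, ∑ r : Fˣ, ∑ z : Fˣ, χ₁ (p * z : Fˣ) * (χ₂ (r * z : Fˣ) * (χ₃ z *
        (χ₄ ((p * z) * (r * z) * z⁻¹ : Fˣ) *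
          offDiagKernel ψ (p * z) (r * z) z ((p * z) * (r * z) * z⁻¹)))) :=
        Finset.sum_congr rfl fun x _ => Finset.sum_comm
    _ = _ := by
        refine Finset.sum_congr rfl fun p _ => Finset.sum_congr rfl fun r _ =>
          Finset.sum_congr rfl fun z _ => ?_
        have e : (p * z) * (r * z) * z⁻¹ = p * r * z := by group; simp [mul_comm, mul_left_comm]
        have e2 : ((p * z : Fˣ) : F) + (r * z : Fˣ) - z - (p * r * z : Fˣ) =
            -((1 - (p : F)) * (1 - r)) * z := by push_cast; ring
        rw [e, offDiagKernel, if_pos (by simp [mul_comm, mul_left_comm]), e2]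
        simp only [mul_eq_right, Units.val_mul, map_mul, MulChar.mul_apply]
        ring

/-- If `χ₁ χ₂ χ₃ χ₄` is nontrivial, the sum is a Gauss sum times two Jacobi sums. If it is trivial,
the corrections in the kernel cancel everything of order larger than `q`. -/
theorem norm_sum_mulChar_offDiagKernel_le {F : Type v} [Field F] [Fintype F] [DecidableEq F]
    {ψ : AddChar F ℂ} (hψ : ψ ≠ 1) (χ₁ χ₂ χ₃ χ₄ : MulChar F ℂ) :
    ‖∑ x : Fˣ, χ₁ x * ∑ y : Fˣ, χ₂ y * ∑ z : Fˣ, χ₃ z * ∑ v : Fˣ, χ₄ v * offDiagKernel ψ x y z v‖ ≤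
      3 * (Fintype.card F * √(Fintype.card F)) := by
  rw [sum_mulChar_offDiagKernel]
  set φ₁ := χ₁ * χ₄
  set φ₂ := χ₂ * χ₄
  set χ := χ₁ * χ₂ * χ₃ * χ₄
  have hq := one_le_sqrt_card F
  have hs : √(Fintype.card F : ℝ) * √(Fintype.card F) = Fintype.card F :=
    Real.mul_self_sqrt (by positivity)
  by_cases hχ : χ = 1
  · have hin : ∀ p r : Fˣ, ∑ z : Fˣ, χ z *
        (ψ (-((1 - (p : F)) * (1 - r)) * z) - (if p = 1 then 1 else 0) - (if r = 1 then 1 else 0)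
          + 1 / (Fintype.card Fˣ : ℂ)) =
        (if p = 1 then 1 else 0) + (if r = 1 then 1 else 0) -
          (if p = 1 then if r = 1 then (Fintype.card F : ℂ) else 0 else 0) := by
      intro p r
      have h1 : ∀ z : Fˣ, (1 : MulChar F ℂ) z = 1 := fun z => MulChar.one_apply_coe z
      have h0 : (Fintype.card Fˣ : ℂ) ≠ 0 := by exact_mod_cast Fintype.card_ne_zero
      have hN : (Fintype.card Fˣ : ℂ) = Fintype.card F - 1 := by
        rw [Fintype.card_units, Nat.cast_sub Fintype.card_pos, Nat.cast_one]
      simp only [hχ, h1, one_mul, Finset.sum_add_distrib, Finset.sum_sub_distrib,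
        sum_units_addChar hψ, Finset.sum_const, Finset.card_univ, nsmul_eq_mul]
      rw [mul_one_div_cancel h0, hN]
      have hp : p = 1 ↔ 1 - (p : F) = 0 := by rw [sub_eq_zero, eq_comm (a := (1 : F)), Units.val_eq_one]
      have hr : r = 1 ↔ 1 - (r : F) = 0 := by rw [sub_eq_zero, eq_comm (a := (1 : F)), Units.val_eq_one]
      by_cases h : p = 1 <;> by_cases h' : r = 1 <;>
        simp [h, h', neg_eq_zero, mul_eq_zero, ← hp, ← hr]
      ring
    simp only [hin]
    have hsum : ∑ p : Fˣ, ∑ r : Fˣ, φ₁ p * φ₂ r * ((if p = 1 then 1 else 0) +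
        (if r = 1 then 1 else 0) -
          (if p = 1 then if r = 1 then (Fintype.card F : ℂ) else 0 else 0)) =
        ∑ r : Fˣ, φ₂ r + ∑ p : Fˣ, φ₁ p - Fintype.card F := by
      simp only [mul_sub, mul_add, Finset.sum_add_distrib, Finset.sum_sub_distrib, mul_ite,
        mul_one, mul_zero, Finset.sum_ite_eq', Finset.mem_univ, if_true]
      rw [Finset.sum_comm]
      simp
    rw [hsum]
    have hb : ∀ φ : MulChar F ℂ, ‖∑ x : Fˣ, φ x‖ ≤ Fintype.card F := by
      intro φ
      refine (norm_sum_le _ _).trans ?_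
      simp only [MulChar.norm_apply_unit, Finset.sum_const, Finset.card_univ, nsmul_eq_mul,
        mul_one, Fintype.card_units]
      exact_mod_cast Nat.sub_le _ _
    calc _ ≤ ‖∑ r : Fˣ, φ₂ r‖ + ‖∑ p : Fˣ, φ₁ p‖ + ‖(Fintype.card F : ℂ)‖ :=
          (norm_sub_le _ _).trans (by gcongr; exact norm_add_le _ _)
      _ ≤ Fintype.card F + Fintype.card F + Fintype.card F := by
          gcongr
          · exact hb _
          · exact hb _
          · simp
      _ ≤ _ := by
          have : (Fintype.card F : ℝ) * 1 ≤ Fintype.card F * √(Fintype.card F) := by gcongr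
          linarith
  · have hin : ∀ p r : Fˣ, ∑ z : Fˣ, χ z *
        (ψ (-((1 - (p : F)) * (1 - r)) * z) - (if p = 1 then 1 else 0) - (if r = 1 then 1 else 0)
          + 1 / (Fintype.card Fˣ : ℂ)) =
        χ⁻¹ (-1) * gaussSum χ ψ * (χ⁻¹ (1 - p) * χ⁻¹ (1 - r)) := by
      intro p r
      simp only [mul_sub, mul_add, Finset.sum_add_distrib, Finset.sum_sub_distrib,
        ← Finset.sum_mul, sum_units_mulChar_eq_zero hχ, zero_mul, sub_zero, add_zero]
      rw [sum_units_mulChar_mul_addChar hχ, neg_eq_neg_one_mul, ← map_mul, mul_right_comm,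
        ← map_mul]
      ring_nf
    have hsum : ∑ p : Fˣ, ∑ r : Fˣ, φ₁ p * φ₂ r *
          (χ⁻¹ (-1) * gaussSum χ ψ * (χ⁻¹ (1 - p) * χ⁻¹ (1 - r))) =
        χ⁻¹ (-1) * gaussSum χ ψ * (jacobiSum φ₁ χ⁻¹ * jacobiSum φ₂ χ⁻¹) := by
      rw [jacobiSum, jacobiSum, ← sum_units_mulChar_mul φ₁ fun x => χ⁻¹ (1 - x),
        ← sum_units_mulChar_mul φ₂ fun x => χ⁻¹ (1 - x), Finset.sum_mul_sum, Finset.mul_sum]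
      refine Finset.sum_congr rfl fun p _ => ?_
      rw [Finset.mul_sum]
      exact Finset.sum_congr rfl fun r _ => by ring
    have h1 : ‖χ⁻¹ (-1)‖ = 1 := by
      have := MulChar.norm_apply_unit χ⁻¹ (-1)
      rwa [Units.val_neg, Units.val_one] at this
    simp only [hin]
    rw [hsum, norm_mul, norm_mul, norm_mul, h1, one_mul, norm_gaussSum_eq_sqrt hχ hψ]
    calc _ ≤ √(Fintype.card F : ℝ) * (√(Fintype.card F) * √(Fintype.card F)) := by
          gcongr
          · exact norm_jacobiSum_le _ (inv_ne_one.2 hχ)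
          · exact norm_jacobiSum_le _ (inv_ne_one.2 hχ)
      _ = Fintype.card F * √(Fintype.card F) := by rw [hs]; ring
      _ ≤ _ := le_mul_of_one_le_left (by positivity) (by norm_num)

/-! ### Incomplete sums and multiplicative characters -/

theorem norm_geom_sum_le {y : ℝ} (hy0 : 0 < y) (hy1 : y < 1) (s : ℕ) :
    ‖∑ j ∈ Finset.range s, Complex.exp (Complex.I * (2 * Real.pi * y : ℝ)) ^ j‖ ≤
      1 / 2 * (1 / y + 1 / (1 - y)) := by
  have key : ∀ t : ℝ, 0 ≤ t → t ≤ 1 / 2 → 2 * t ≤ Real.sin (Real.pi * t) := by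
    intro t h0 h1
    have h := Real.mul_le_sin (x := Real.pi * t) (by positivity) (by nlinarith [Real.pi_pos])
    have e : 2 / Real.pi * (Real.pi * t) = 2 * t := by field_simp
    linarith
  have hsin : 1 / Real.sin (Real.pi * y) ≤ 1 / 2 * (1 / y + 1 / (1 - y)) := by
    have hy1' : 0 < 1 - y := by linarith
    rcases le_total y (1 / 2) with h | h
    · have := key y hy0.le h
      calc _ ≤ 1 / (2 * y) := one_div_le_one_div_of_le (by positivity) this
        _ = 1 / 2 * (1 / y + 0) := by field_simp; ring
        _ ≤ _ := by gcongr; positivity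
    · have := key (1 - y) hy1'.le (by linarith)
      rw [show Real.pi * (1 - y) = Real.pi - Real.pi * y by ring, Real.sin_pi_sub] at this
      calc _ ≤ 1 / (2 * (1 - y)) := one_div_le_one_div_of_le (by positivity) this
        _ = 1 / 2 * (0 + 1 / (1 - y)) := by field_simp; ring
        _ ≤ _ := by gcongr; positivity
  have hpos : 0 < Real.sin (Real.pi * y) :=
    Real.sin_pos_of_pos_of_lt_pi (by positivity) (by nlinarith [Real.pi_pos])
  have hnorm : ‖Complex.exp (Complex.I * (2 * Real.pi * y : ℝ)) - 1‖ =
      2 * Real.sin (Real.pi * y) := by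
    rw [Complex.norm_exp_I_mul_ofReal_sub_one, show 2 * Real.pi * y / 2 = Real.pi * y by ring,
      Real.norm_of_nonneg (by positivity)]
  have hne : Complex.exp (Complex.I * (2 * Real.pi * y : ℝ)) ≠ 1 := by
    intro h
    rw [h, sub_self, norm_zero] at hnorm
    linarith
  rw [geom_sum_eq hne, norm_div, hnorm]
  have hnum : ‖Complex.exp (Complex.I * (2 * Real.pi * y : ℝ)) ^ s - 1‖ ≤ 2 := by
    refine (norm_sub_le _ _).trans ?_
    rw [norm_pow, Complex.norm_exp_I_mul_ofReal, one_pow, norm_one]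
    norm_num
  calc _ ≤ 2 / (2 * Real.sin (Real.pi * y)) := by gcongr
    _ = 1 / Real.sin (Real.pi * y) := by field_simp
    _ ≤ _ := hsin

/-- The term `m = 0` is `1 / 0 = 0`. -/
theorem sum_range_inv_le (N : ℕ) :
    ∑ m ∈ Finset.range N, (1 / m : ℝ) ≤ 1 + Real.log N := by
  rcases N with _ | N
  · simp
  have h := harmonic_le_one_add_log N
  rw [harmonic] at h
  push_cast at h
  rw [Finset.sum_range_succ']
  have hlog : Real.log N ≤ Real.log (N + 1 : ℕ) := by
    rcases N.eq_zero_or_pos with rfl | hN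
    · simp
    · exact Real.log_le_log (by exact_mod_cast hN) (by push_cast; linarith)
  simp only [one_div, Nat.cast_add, Nat.cast_one, Nat.cast_zero, inv_zero, add_zero] at *
  linarith

/-- The `L¹` bound for the Dirichlet kernel, on a set of `N` equally spaced points that may be
shifted arbitrarily. -/
theorem sum_norm_geom_sum_le {N : ℕ} {δ : ℝ} (hδ0 : 0 < δ) (hδ1 : δ ≤ 1) (s : ℕ) :
    ∑ m ∈ Finset.range N,
      ‖∑ j ∈ Finset.range s, Complex.exp (Complex.I * (2 * Real.pi * ((m + δ) / N) : ℝ)) ^ j‖ ≤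
      2 * s + N * (1 + Real.log N) := by
  rcases N.eq_zero_or_pos with rfl | hN
  · simp
  have hN' : (0 : ℝ) < N := by exact_mod_cast hN
  -- The endpoints get the trivial bound `s`. Elsewhere the distances of `(m + δ) / N` to `0` and `1`
  -- are at least `m / N` and `(N - 1 - m) / N`; the denominators that vanish at the endpoints give
  -- the value `0`.
  have hterm : ∀ m ∈ Finset.range N,
      ‖∑ j ∈ Finset.range s, Complex.exp (Complex.I * (2 * Real.pi * ((m + δ) / N) : ℝ)) ^ j‖ ≤
      (if m = 0 then (s : ℝ) else 0) + (if m = N - 1 then (s : ℝ) else 0) +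
        N / 2 * (1 / m + 1 / (N - 1 - m : ℕ)) := by
    intro m hm
    have hmN := Finset.mem_range.1 hm
    have hn : (0 : ℝ) ≤ N / 2 * (1 / m + 1 / (N - 1 - m : ℕ)) := by positivity
    have htriv : ‖∑ j ∈ Finset.range s,
        Complex.exp (Complex.I * (2 * Real.pi * ((m + δ) / N) : ℝ)) ^ j‖ ≤ s := by
      refine (norm_sum_le _ _).trans ?_
      simp only [norm_pow, Complex.norm_exp_I_mul_ofReal, one_pow, Finset.sum_const,
        Finset.card_range, nsmul_eq_mul, mul_one, le_refl]
    by_cases h0 : m = 0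
    · rw [if_pos h0]
      have : (0 : ℝ) ≤ if m = N - 1 then (s : ℝ) else 0 := by positivity
      linarith
    by_cases h1 : m = N - 1
    · rw [if_pos h1]
      have : (0 : ℝ) ≤ if m = 0 then (s : ℝ) else 0 := by positivity
      linarith
    rw [if_neg h0, if_neg h1, zero_add, zero_add]
    have hm0 : (0 : ℝ) < m := by exact_mod_cast Nat.pos_of_ne_zero h0
    obtain ⟨r, hr⟩ : ∃ r, N = m + r + 2 := ⟨N - m - 2, by omega⟩
    have hr' : N - 1 - m = r + 1 := by omega
    have hNr : (N : ℝ) = m + r + 2 := by rw [hr]; push_cast; ring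
    have hy1 : (m + δ) / N < 1 := by rw [div_lt_one hN']; linarith [(Nat.cast_nonneg r : (0:ℝ) ≤ r)]
    refine (norm_geom_sum_le (y := (m + δ) / N) (by positivity) hy1 s).trans ?_
    have h1y : 1 - (m + δ) / N = (r + 2 - δ) / N := by
      field_simp
      linarith
    rw [h1y, hr', one_div_div, one_div_div]
    have hr0 : (0 : ℝ) ≤ r := Nat.cast_nonneg r
    calc 1 / 2 * (N / (m + δ) + N / (r + 2 - δ)) ≤ 1 / 2 * (N / (m : ℝ) + N / ((r + 1 : ℕ) : ℝ)) := by
          gcongr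
          · linarith
          · push_cast; linarith
      _ = _ := by ring
  refine (Finset.sum_le_sum hterm).trans ?_
  have hh := sum_range_inv_le N
  have hrefl : ∑ m ∈ Finset.range N, (1 / (N - 1 - m : ℕ) : ℝ) =
      ∑ m ∈ Finset.range N, (1 / m : ℝ) := Finset.sum_range_reflect (fun m => (1 / m : ℝ)) N
  have i0 : 0 < N := hN
  have i1 : N - 1 < N := by omega
  rw [Finset.sum_add_distrib, Finset.sum_add_distrib, ← Finset.mul_sum, Finset.sum_add_distrib,
    hrefl, Finset.sum_ite_eq', Finset.sum_ite_eq', if_pos (Finset.mem_range.2 i0),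
    if_pos (Finset.mem_range.2 i1)]
  nlinarith

theorem MulChar.zpow_apply_unit {F : Type v} [Field F] (χ : MulChar F ℂ) (k : ℤ) (x : Fˣ) :
    (χ ^ k) x = χ x ^ k := by
  have h := congrArg (fun φ : Fˣ →* ℂˣ => ((φ x : ℂˣ) : ℂ)) (map_zpow MulChar.mulEquivToUnitHom χ k)
  have e : ∀ φ : MulChar F ℂ, ((MulChar.mulEquivToUnitHom φ x : ℂˣ) : ℂ) = φ x :=
    fun φ => MulChar.coe_toUnitHom φ x
  simp only [e] at h
  rw [h, ← e χ, ← Units.val_zpow_eq_zpow_val]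
  rfl

/-- A generator of the group of multiplicative characters, together with the orthogonality
relation for any `q - 1` consecutive powers of it. -/
theorem exists_mulChar_generator {F : Type v} [Field F] [Fintype F] [DecidableEq F] {g : Fˣ}
    (hg : ∀ x, x ∈ Subgroup.zpowers g) : ∃ χ : MulChar F ℂ,
      χ g = Complex.exp (Complex.I * (2 * Real.pi / Fintype.card Fˣ : ℝ)) ∧
      ∀ (k : ℤ) (y : Fˣ), ∑ m ∈ Finset.range (Fintype.card Fˣ), (χ ^ (k - m)) y =
        if y = 1 then (Fintype.card Fˣ : ℂ) else 0 := by
  set N := Fintype.card Fˣ with hNdef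
  have hN : N ≠ 0 := Fintype.card_ne_zero
  have hprim := Complex.isPrimitiveRoot_exp N hN
  set ζ := Complex.exp (2 * Real.pi * Complex.I / N) with hζ
  have hζ' : ζ = Complex.exp (Complex.I * (2 * Real.pi / N : ℝ)) := by
    rw [hζ]; congr 1; push_cast; ring
  let ζu : ℂˣ := Units.mk0 ζ (Complex.exp_ne_zero _)
  have hmem : ζu ∈ rootsOfUnity (Fintype.card Fˣ) ℂ := by
    rw [mem_rootsOfUnity, Units.ext_iff, Units.val_pow_eq_pow_val]
    exact hprim.pow_eq_one
  have hspec := MulChar.ofRootOfUnity_spec hmem hg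
  set χ := MulChar.ofRootOfUnity hmem hg
  refine ⟨χ, by rw [hspec, ← hζ']; rfl, fun k y => ?_⟩
  simp only [MulChar.zpow_apply_unit]
  have hpow : ∀ n : ℤ, χ (g ^ n : Fˣ) = ζ ^ n := by
    intro n
    have e : χ (g ^ n : Fˣ) = (χ.toUnitHom (g ^ n) : ℂˣ) := (MulChar.coe_toUnitHom χ _).symm
    rw [e, map_zpow, Units.val_zpow_eq_zpow_val, MulChar.coe_toUnitHom, hspec]
    rfl
  by_cases hy : y = 1
  · simp [hy]
  rw [if_neg hy]
  obtain ⟨n, rfl⟩ := Subgroup.mem_zpowers_iff.1 (hg y)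
  have hη : ζ ^ n ≠ 1 := by
    intro h
    apply hy
    rw [← orderOf_dvd_iff_zpow_eq_one, orderOf_eq_card_of_forall_mem_zpowers hg,
      Nat.card_eq_fintype_card]
    exact (hprim.zpow_eq_one_iff_dvd n).1 h
  have hη0 : ζ ^ n ≠ 0 := zpow_ne_zero _ (Complex.exp_ne_zero _)
  rw [hpow]
  have hsplit : ∀ m ∈ Finset.range N, (ζ ^ n) ^ (k - m : ℤ) = (ζ ^ n) ^ k * ((ζ ^ n)⁻¹) ^ m := by
    intro m _
    rw [zpow_sub₀ hη0, zpow_natCast, inv_pow, div_eq_mul_inv]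
  rw [Finset.sum_congr rfl hsplit, ← Finset.mul_sum,
    geom_sum_eq (fun h => hη (inv_eq_one.1 h))]
  have h1 : ((ζ ^ n)⁻¹) ^ N = 1 := by
    rw [inv_pow, ← zpow_natCast, ← zpow_mul, mul_comm, zpow_mul, zpow_natCast, hprim.pow_eq_one,
      one_zpow, inv_one]
  rw [h1, sub_self, zero_div, mul_zero]

/-- A sum of length `s` over the powers of a generator, twisted by a unimodular geometric
progression, costs only a factor `2 s / (q - 1) + 1 + log (q - 1)` over the complete sums. -/
theorem norm_sum_pow_mul_le {F : Type v} [Field F] [Fintype F] [DecidableEq F] {g : Fˣ}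
    (hg : ∀ x, x ∈ Subgroup.zpowers g) (s : ℕ) (θ : ℝ) {φ : Fˣ → ℂ} {B : ℝ}
    (hφ : ∀ χ : MulChar F ℂ, ‖∑ x : Fˣ, χ x * φ x‖ ≤ B) :
    ‖∑ j ∈ Finset.range s, Complex.exp (Complex.I * θ) ^ j * φ (g ^ j)‖ ≤
      (2 * s / Fintype.card Fˣ + (1 + Real.log (Fintype.card Fˣ))) * B := by
  obtain ⟨χ, hχg, horth⟩ := exists_mulChar_generator hg
  set N := Fintype.card Fˣ with hNdef
  have hN : (0 : ℝ) < N := by exact_mod_cast Fintype.card_pos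
  have hN0 : (N : ℂ) ≠ 0 := by exact_mod_cast hN.ne'
  -- the shift places the frequencies `θ - 2 π (k - m) / N` in `(0, 2 π]`
  set k : ℤ := ⌈N * θ / (2 * Real.pi)⌉ - 1 with hk
  set δ : ℝ := N * θ / (2 * Real.pi) - k with hδ
  have hδ0 : 0 < δ := by
    have := Int.ceil_lt_add_one (N * θ / (2 * Real.pi))
    rw [hδ, hk]; push_cast; linarith
  have hδ1 : δ ≤ 1 := by
    have := Int.le_ceil (N * θ / (2 * Real.pi))
    rw [hδ, hk]; push_cast; linarith
  set D : ℕ → ℂ := fun m => ∑ j ∈ Finset.range s,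
    Complex.exp (Complex.I * (2 * Real.pi * ((m + δ) / N) : ℝ)) ^ j with hD
  have hDj : ∀ m j : ℕ, Complex.exp (Complex.I * (2 * Real.pi * ((m + δ) / N) : ℝ)) ^ j =
      Complex.exp (Complex.I * θ) ^ j * (χ ^ (k - m)) ((g ^ j : Fˣ)⁻¹ : Fˣ) := by
    intro m j
    have e1 : (χ ^ (k - m)) ((g ^ j : Fˣ)⁻¹ : Fˣ) = ((χ g) ^ (-(k - m : ℤ))) ^ j := by
      rw [MulChar.zpow_apply_unit, ← MulChar.coe_toUnitHom, ← MulChar.coe_toUnitHom, map_inv,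
        map_pow, ← Units.val_zpow_eq_zpow_val, ← Units.val_zpow_eq_zpow_val,
        ← Units.val_pow_eq_pow_val]
      congr 1
      rw [← zpow_natCast, ← zpow_natCast, ← zpow_neg, ← zpow_mul, ← zpow_mul]
      congr 1
      ring
    rw [e1, ← mul_pow, hχg, ← Complex.exp_int_mul, ← Complex.exp_add]
    congr 2
    rw [hδ]
    push_cast
    have hpi : (Real.pi : ℂ) ≠ 0 := by exact_mod_cast Real.pi_ne_zero
    field_simp
    ring
  have hid : ∑ j ∈ Finset.range s, Complex.exp (Complex.I * θ) ^ j * φ (g ^ j) =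
      ∑ m ∈ Finset.range N, 1 / (N : ℂ) * D m * ∑ x : Fˣ, (χ ^ (k - m)) x * φ x := by
    have hpick : ∀ j : ℕ, φ (g ^ j) = ∑ x : Fˣ, 1 / (N : ℂ) *
        (∑ m ∈ Finset.range N, (χ ^ (k - m)) (x * (g ^ j)⁻¹ : Fˣ)) * φ x := by
      intro j
      rw [Finset.sum_eq_single (g ^ j)]
      · rw [horth, if_pos (mul_inv_cancel _), one_div_mul_cancel hN0, one_mul]
      · intro x _ hx
        rw [horth, if_neg (fun h => hx (by simpa using mul_inv_eq_one.1 h)), mul_zero, zero_mul]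
      · simp
    have hterm : ∀ (j m : ℕ) (x : Fˣ), (χ ^ (k - m)) (x * (g ^ j)⁻¹ : Fˣ) =
        (χ ^ (k - m)) x * (χ ^ (k - m)) ((g ^ j : Fˣ)⁻¹ : Fˣ) := by
      intro j m x
      rw [Units.val_mul, map_mul]
    calc _ = ∑ j ∈ Finset.range s, ∑ x : Fˣ, ∑ m ∈ Finset.range N,
          1 / (N : ℂ) * (Complex.exp (Complex.I * θ) ^ j * (χ ^ (k - m)) ((g ^ j : Fˣ)⁻¹ : Fˣ)) *
            ((χ ^ (k - m)) x * φ x) := by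
          refine Finset.sum_congr rfl fun j _ => ?_
          rw [hpick, Finset.mul_sum]
          refine Finset.sum_congr rfl fun x _ => ?_
          rw [Finset.mul_sum, Finset.sum_mul, Finset.mul_sum]
          refine Finset.sum_congr rfl fun m _ => ?_
          rw [hterm]
          ring
      _ = ∑ j ∈ Finset.range s, ∑ m ∈ Finset.range N, ∑ x : Fˣ,
          1 / (N : ℂ) * (Complex.exp (Complex.I * θ) ^ j * (χ ^ (k - m)) ((g ^ j : Fˣ)⁻¹ : Fˣ)) *
            ((χ ^ (k - m)) x * φ x) := Finset.sum_congr rfl fun j _ => Finset.sum_comm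
      _ = _ := by
          rw [Finset.sum_comm]
          refine Finset.sum_congr rfl fun m _ => ?_
          rw [hD]
          simp only [hDj, Finset.mul_sum, Finset.sum_mul]
          rw [Finset.sum_comm]
  rw [hid]
  calc _ ≤ ∑ m ∈ Finset.range N, 1 / (N : ℝ) * ‖D m‖ * B := by
        refine (norm_sum_le _ _).trans (Finset.sum_le_sum fun m _ => ?_)
        rw [norm_mul, norm_mul, norm_div, norm_one, Complex.norm_natCast]
        gcongr
        exact hφ _
    _ = 1 / N * (∑ m ∈ Finset.range N, ‖D m‖) * B := by rw [Finset.mul_sum, Finset.sum_mul]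
    _ ≤ 1 / N * (2 * s + N * (1 + Real.log N)) * B := by
        have hB : 0 ≤ B := (norm_nonneg _).trans (hφ 1)
        gcongr
        exact sum_norm_geom_sum_le hδ0 hδ1 s
    _ = _ := by field_simp

/-- The previous bound applied in each of four variables; the complete sums are nested in the
reverse order because the variables are completed one after the other. -/
theorem norm_sum_pow_four_le {F : Type v} [Field F] [Fintype F] [DecidableEq F] {g : Fˣ}
    (hg : ∀ x, x ∈ Subgroup.zpowers g) (s : ℕ) (θ₁ θ₂ θ₃ θ₄ : ℝ) {K : Fˣ → Fˣ → Fˣ → Fˣ → ℂ} {B : ℝ}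
    (hK : ∀ χ₁ χ₂ χ₃ χ₄ : MulChar F ℂ, ‖∑ v : Fˣ, χ₄ v * ∑ z : Fˣ, χ₃ z * ∑ y : Fˣ, χ₂ y *
      ∑ x : Fˣ, χ₁ x * K x y z v‖ ≤ B) :
    ‖∑ a ∈ Finset.range s, Complex.exp (Complex.I * θ₁) ^ a *
      ∑ b ∈ Finset.range s, Complex.exp (Complex.I * θ₂) ^ b *
      ∑ c ∈ Finset.range s, Complex.exp (Complex.I * θ₃) ^ c *
      ∑ d ∈ Finset.range s, Complex.exp (Complex.I * θ₄) ^ d *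
        K (g ^ a) (g ^ b) (g ^ c) (g ^ d)‖ ≤
      (2 * s / Fintype.card Fˣ + (1 + Real.log (Fintype.card Fˣ))) ^ 4 * B := by
  have swap : ∀ (χ : MulChar F ℂ) (θ : ℝ) (Φ : Fˣ → ℕ → ℂ),
      ∑ x : Fˣ, χ x * ∑ b ∈ Finset.range s, Complex.exp (Complex.I * θ) ^ b * Φ x b =
        ∑ b ∈ Finset.range s, Complex.exp (Complex.I * θ) ^ b * ∑ x : Fˣ, χ x * Φ x b := by
    intro χ θ Φ
    simp only [Finset.mul_sum]
    rw [Finset.sum_comm]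
    exact Finset.sum_congr rfl fun _ _ => Finset.sum_congr rfl fun _ _ => mul_left_comm _ _ _
  set L := 2 * s / (Fintype.card Fˣ : ℝ) + (1 + Real.log (Fintype.card Fˣ))
  have e : L ^ 4 * B = L * (L * (L * (L * B))) := by ring
  rw [e]
  refine norm_sum_pow_mul_le hg s θ₁ (φ := fun x => ∑ b ∈ Finset.range s,
    Complex.exp (Complex.I * θ₂) ^ b * ∑ c ∈ Finset.range s, Complex.exp (Complex.I * θ₃) ^ c *
      ∑ d ∈ Finset.range s, Complex.exp (Complex.I * θ₄) ^ d * K x (g ^ b) (g ^ c) (g ^ d))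
    fun χ₁ => ?_
  rw [swap]
  refine norm_sum_pow_mul_le hg s θ₂ (φ := fun y => ∑ x : Fˣ, χ₁ x *
    ∑ c ∈ Finset.range s, Complex.exp (Complex.I * θ₃) ^ c *
      ∑ d ∈ Finset.range s, Complex.exp (Complex.I * θ₄) ^ d * K x y (g ^ c) (g ^ d))
    fun χ₂ => ?_
  simp only [swap]
  refine norm_sum_pow_mul_le hg s θ₃ (φ := fun z => ∑ d ∈ Finset.range s,
      Complex.exp (Complex.I * θ₄) ^ d * ∑ y : Fˣ, χ₂ y * ∑ x : Fˣ, χ₁ x * K x y z (g ^ d))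
    fun χ₃ => ?_
  rw [swap]
  exact norm_sum_pow_mul_le hg s θ₄ (φ := fun v => ∑ z : Fˣ, χ₃ z * ∑ y : Fˣ, χ₂ y *
    ∑ x : Fˣ, χ₁ x * K x y z v) fun χ₄ => hK χ₁ χ₂ χ₃ χ₄

/-! ### Means over the unit circle -/

theorem lrNorm_pow_self (n : ℕ) (hn : n ≠ 0) (f : Polynomial ℂ) :
    lrNorm n f ^ n = (1 / (2 * Real.pi)) *
      ∫ θ in (0 : ℝ)..(2 * Real.pi), ‖f.eval (Complex.exp (Complex.I * (θ : ℂ)))‖ ^ n := by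
  have h0 : 0 ≤ (1 / (2 * Real.pi)) *
      ∫ θ in (0 : ℝ)..(2 * Real.pi), ‖f.eval (Complex.exp (Complex.I * (θ : ℂ)))‖ ^ n :=
    mul_nonneg (by positivity)
      (intervalIntegral.integral_nonneg (by positivity) fun _ _ => by positivity)
  simp only [lrNorm, Real.rpow_natCast]
  rw [← Real.rpow_natCast, ← Real.rpow_mul h0, one_div_mul_cancel (by exact_mod_cast hn),
    Real.rpow_one]

theorem integral_exp_int_mul (n : ℤ) :
    ∫ θ in (0 : ℝ)..(2 * Real.pi), Complex.exp (Complex.I * n * θ) =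
      if n = 0 then (2 * Real.pi : ℂ) else 0 := by
  by_cases h : n = 0
  · simp [h]
  · have hc : Complex.I * n ≠ 0 := mul_ne_zero Complex.I_ne_zero (by exact_mod_cast h)
    rw [if_neg h, integral_exp_mul_complex hc]
    have : Complex.exp (Complex.I * n * (2 * Real.pi : ℝ)) = 1 := by
      rw [Complex.exp_eq_one_iff]
      exact ⟨n, by push_cast; ring⟩
    rw [this]
    simp

/-- The mean of a trigonometric sum over a period picks out the terms of frequency zero. -/
theorem mean_trigSum {ι : Type*} (T : Finset ι) (A : ι → ℂ) (n : ι → ℤ) :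
    (1 / (2 * Real.pi) : ℂ) * ∫ θ in (0 : ℝ)..(2 * Real.pi),
      ∑ i ∈ T, A i * Complex.exp (Complex.I * n i * θ) = ∑ i ∈ T with n i = 0, A i := by
  rw [intervalIntegral.integral_finsetSum
    fun i _ => (by fun_prop : Continuous fun θ : ℝ =>
      A i * Complex.exp (Complex.I * n i * θ)).intervalIntegrable _ _, Finset.mul_sum,
    Finset.sum_filter]
  refine Finset.sum_congr rfl fun i _ => ?_
  rw [intervalIntegral.integral_const_mul, integral_exp_int_mul]
  have hpi : (Real.pi : ℂ) ≠ 0 := by exact_mod_cast Real.pi_ne_zero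
  split_ifs
  · field_simp
  · simp

theorem norm_sum_filter_le_of_norm_trigSum_le {ι : Type*} (T : Finset ι) (A : ι → ℂ) (n : ι → ℤ)
    {B : ℝ} (hB : ∀ θ : ℝ, ‖∑ i ∈ T, A i * Complex.exp (Complex.I * n i * θ)‖ ≤ B) :
    ‖∑ i ∈ T with n i = 0, A i‖ ≤ B := by
  rw [← mean_trigSum, norm_mul]
  have h := intervalIntegral.norm_integral_le_of_norm_le_const
    (a := 0) (b := 2 * Real.pi) fun θ _ => hB θ
  rw [sub_zero, abs_of_pos Real.two_pi_pos] at h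
  have hn : ‖(1 / (2 * Real.pi) : ℂ)‖ = 1 / (2 * Real.pi) := by
    rw [show (1 / (2 * Real.pi) : ℂ) = ((1 / (2 * Real.pi) : ℝ) : ℂ) by push_cast; rfl,
      Complex.norm_of_nonneg (by positivity)]
  rw [hn]
  calc _ ≤ 1 / (2 * Real.pi) * (B * (2 * Real.pi)) := by gcongr
    _ = B := by field_simp [Real.pi_ne_zero]

/-- The quadruples `(a, b, c, d)` of exponents below `s`. -/
def expQuads (s : ℕ) : Finset (ℕ × ℕ × ℕ × ℕ) :=
  Finset.range s ×ˢ Finset.range s ×ˢ Finset.range s ×ˢ Finset.range s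

theorem sum_expQuads_mul (s : ℕ) (f₁ f₂ f₃ f₄ : ℕ → ℂ) :
    ∑ i ∈ expQuads s, f₁ i.1 * f₂ i.2.1 * f₃ i.2.2.1 * f₄ i.2.2.2 =
      (∑ a ∈ Finset.range s, f₁ a) * (∑ b ∈ Finset.range s, f₂ b) *
        (∑ c ∈ Finset.range s, f₃ c) * ∑ d ∈ Finset.range s, f₄ d := by
  simp only [expQuads, Finset.sum_product, ← Finset.mul_sum, ← Finset.sum_mul]

/-- The quadruples `(a, b, c, d)` of exponents below `s` with `a + b = c + d`. -/
def additiveQuads (s : ℕ) : Finset (ℕ × ℕ × ℕ × ℕ) :=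
  {i ∈ expQuads s | i.1 + i.2.1 = i.2.2.1 + i.2.2.2}

theorem additiveQuads_eq (s : ℕ) : additiveQuads s =
    {i ∈ expQuads s | (i.1 : ℤ) + i.2.1 - i.2.2.1 - i.2.2.2 = 0} := by
  refine Finset.filter_congr fun i _ => ?_
  omega

theorem exp_I_mul_quad (i : ℕ × ℕ × ℕ × ℕ) (θ : ℝ) :
    Complex.exp (Complex.I * ((i.1 + i.2.1 - i.2.2.1 - i.2.2.2 : ℤ) : ℂ) * θ) =
      Complex.exp (Complex.I * θ) ^ i.1 * Complex.exp (Complex.I * θ) ^ i.2.1 *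
        Complex.exp (Complex.I * (-θ : ℝ)) ^ i.2.2.1 *
        Complex.exp (Complex.I * (-θ : ℝ)) ^ i.2.2.2 := by
  simp only [← Complex.exp_nat_mul, ← Complex.exp_add]
  congr 1
  push_cast
  ring

theorem eval_sum_C_mul_X_pow (c : ℕ → ℂ) (s : ℕ) (z : ℂ) :
    (∑ j ∈ Finset.range s, Polynomial.C (c j) * Polynomial.X ^ j).eval z =
      ∑ j ∈ Finset.range s, c j * z ^ j := by
  simp [Polynomial.eval_finsetSum]

theorem conj_exp_I_mul (θ : ℝ) :
    (starRingEnd ℂ) (Complex.exp (Complex.I * θ)) = Complex.exp (Complex.I * (-θ : ℝ)) := by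
  rw [← Complex.exp_conj]
  congr 1
  simp

theorem lrNorm_two_sq (c : ℕ → ℂ) (hc : ∀ j, ‖c j‖ = 1) (s : ℕ) :
    lrNorm 2 (∑ j ∈ Finset.range s, Polynomial.C (c j) * Polynomial.X ^ j) ^ 2 = s := by
  have h := lrNorm_pow_self 2 two_ne_zero
    (∑ j ∈ Finset.range s, Polynomial.C (c j) * Polynomial.X ^ j)
  rw [Nat.cast_ofNat] at h
  rw [h, ← Complex.ofReal_inj]
  rw [Complex.ofReal_mul, ← intervalIntegral.integral_ofReal]
  push_cast
  have hm := mean_trigSum (Finset.range s ×ˢ Finset.range s)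
    (fun i => c i.1 * (starRingEnd ℂ) (c i.2)) (fun i => (i.1 : ℤ) - i.2)
  calc _ = _ := ?_
    _ = _ := hm
    _ = _ := ?_
  · congr 1
    refine intervalIntegral.integral_congr fun θ _ => ?_
    rw [← Complex.ofReal_pow, ← Complex.normSq_eq_norm_sq, ← Complex.mul_conj,
      eval_sum_C_mul_X_pow, map_sum, Finset.sum_mul_sum, Finset.sum_product]
    refine Finset.sum_congr rfl fun a _ => Finset.sum_congr rfl fun b _ => ?_
    rw [map_mul, map_pow, conj_exp_I_mul]
    have e : Complex.exp (Complex.I * ((a - b : ℤ) : ℂ) * θ) =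
        Complex.exp (Complex.I * θ) ^ a * Complex.exp (Complex.I * (-θ : ℝ)) ^ b := by
      simp only [← Complex.exp_nat_mul, ← Complex.exp_add]
      congr 1
      push_cast
      ring
    rw [e]
    ring
  · rw [Finset.sum_filter, Finset.sum_product]
    have : ∀ a ∈ Finset.range s, ∑ b ∈ Finset.range s,
        (if (a : ℤ) - b = 0 then c a * (starRingEnd ℂ) (c b) else 0) = 1 := by
      intro a ha
      rw [Finset.sum_eq_single_of_mem a ha]
      · rw [sub_self, if_pos rfl, Complex.mul_conj, Complex.normSq_eq_norm_sq, hc]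
        simp
      · intro b _ hb
        rw [if_neg (by omega)]
    rw [Finset.sum_congr rfl this]
    simp

theorem lrNorm_four_pow (c : ℕ → ℂ) (s : ℕ) :
    ((lrNorm 4 (∑ j ∈ Finset.range s, Polynomial.C (c j) * Polynomial.X ^ j) ^ 4 : ℝ) : ℂ) =
      ∑ i ∈ additiveQuads s, c i.1 * c i.2.1 * (starRingEnd ℂ) (c i.2.2.1) *
        (starRingEnd ℂ) (c i.2.2.2) := by
  have h := lrNorm_pow_self 4 four_ne_zero
    (∑ j ∈ Finset.range s, Polynomial.C (c j) * Polynomial.X ^ j)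
  rw [Nat.cast_ofNat] at h
  rw [h, Complex.ofReal_mul, ← intervalIntegral.integral_ofReal, additiveQuads_eq, ← mean_trigSum]
  push_cast
  congr 1
  refine intervalIntegral.integral_congr fun θ _ => ?_
  have e4 : ∀ w : ℂ, ((‖w‖ : ℝ) : ℂ) ^ 4 =
      w * (w * ((starRingEnd ℂ) w * (starRingEnd ℂ) w)) := by
    intro w
    have : ((‖w‖ : ℝ) : ℂ) ^ 2 = w * (starRingEnd ℂ) w := by
      rw [Complex.mul_conj, Complex.normSq_eq_norm_sq]; push_cast; rfl
    rw [show ((‖w‖ : ℝ) : ℂ) ^ 4 = (((‖w‖ : ℝ) : ℂ) ^ 2) ^ 2 by ring, this]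
    ring
  rw [e4, eval_sum_C_mul_X_pow, map_sum, ← mul_assoc, ← mul_assoc, ← sum_expQuads_mul]
  refine Finset.sum_congr rfl fun i _ => ?_
  have h4 := exp_I_mul_quad i θ
  simp only [map_mul, map_pow, conj_exp_I_mul]
  push_cast at h4 ⊢
  rw [h4]
  ring

/-! ### The fourth moment of an additive character polynomial -/

theorem norm_sum_offDiagKernel_le {F : Type v} [Field F] [Fintype F] [DecidableEq F]
    {ψ : AddChar F ℂ} (hψ : ψ ≠ 1) {g : Fˣ} (hg : ∀ x, x ∈ Subgroup.zpowers g) (s : ℕ) :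
    ‖∑ i ∈ additiveQuads s, offDiagKernel ψ (g ^ i.1) (g ^ i.2.1) (g ^ i.2.2.1) (g ^ i.2.2.2)‖ ≤
      (2 * s / Fintype.card Fˣ + (1 + Real.log (Fintype.card Fˣ))) ^ 4 *
        (3 * (Fintype.card F * √(Fintype.card F))) := by
  rw [additiveQuads_eq]
  refine norm_sum_filter_le_of_norm_trigSum_le _ _ _ fun θ => ?_
  -- the sums are completed in the order `d, c, b, a`, matching the nesting of the character sums
  have h := norm_sum_pow_four_le hg s (-θ) (-θ) θ θ
    (K := fun x y z v => offDiagKernel ψ v z y x)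
    fun χ₁ χ₂ χ₃ χ₄ => norm_sum_mulChar_offDiagKernel_le hψ χ₄ χ₃ χ₂ χ₁
  convert h using 2
  trans ∑ i ∈ expQuads s, Complex.exp (Complex.I * (-θ : ℝ)) ^ i.1 *
    (Complex.exp (Complex.I * (-θ : ℝ)) ^ i.2.1 * (Complex.exp (Complex.I * θ) ^ i.2.2.1 *
      (Complex.exp (Complex.I * θ) ^ i.2.2.2 *
        offDiagKernel ψ (g ^ i.2.2.2) (g ^ i.2.2.1) (g ^ i.2.1) (g ^ i.1))))
  · refine Finset.sum_nbij' (fun i => (i.2.2.2, i.2.2.1, i.2.1, i.1))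
      (fun i => (i.2.2.2, i.2.2.1, i.2.1, i.1)) ?_ ?_ (fun _ _ => rfl) (fun _ _ => rfl) ?_
    · intro i
      simp only [expQuads, Finset.mem_product]
      tauto
    · intro i
      simp only [expQuads, Finset.mem_product]
      tauto
    · intro i _
      rw [exp_I_mul_quad]
      ring
  · simp only [expQuads, Finset.sum_product, Finset.mul_sum]

/-- The fourth moment up to the error from the off-diagonal kernel. The two diagonals `a ≡ c` and
`b ≡ c` contribute equally, and their overlap is not removed: it is part of the error. -/
theorem abs_lrNorm_four_sub_le {F : Type v} [Field F] [Fintype F] [DecidableEq F]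
    {ψ : AddChar F ℂ} (hψ : ψ ≠ 1) {g : Fˣ} (hg : ∀ x, x ∈ Subgroup.zpowers g) (s : ℕ) :
    |lrNorm 4 (∑ j ∈ Finset.range s, Polynomial.C (ψ (g ^ j : Fˣ)) * Polynomial.X ^ j) ^ 4 -
        (2 * ({i ∈ additiveQuads s | g ^ i.1 = g ^ i.2.2.1}.card : ℝ) -
          (additiveQuads s).card / Fintype.card Fˣ)| ≤
      (2 * s / Fintype.card Fˣ + (1 + Real.log (Fintype.card Fˣ))) ^ 4 *
        (3 * (Fintype.card F * √(Fintype.card F))) := by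
  have hsymm : {i ∈ additiveQuads s | g ^ i.2.1 = g ^ i.2.2.1}.card =
      {i ∈ additiveQuads s | g ^ i.1 = g ^ i.2.2.1}.card := by
    refine Finset.card_bij' (fun i _ => (i.2.1, i.1, i.2.2)) (fun i _ => (i.2.1, i.1, i.2.2))
      ?_ ?_ (fun _ _ => rfl) (fun _ _ => rfl) <;>
    · intro i
      simp only [additiveQuads, expQuads, Finset.mem_filter, Finset.mem_product]
      rintro ⟨⟨⟨h1, h2, h3⟩, h4⟩, h5⟩
      exact ⟨⟨⟨h2, h1, h3⟩, by omega⟩, h5⟩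
  refine le_trans (le_of_eq ?_) (norm_sum_offDiagKernel_le hψ hg s)
  rw [← Real.norm_eq_abs, ← Complex.norm_real]
  congr 1
  rw [Complex.ofReal_sub, lrNorm_four_pow]
  have hK : ∀ i ∈ additiveQuads s,
      offDiagKernel ψ (g ^ i.1) (g ^ i.2.1) (g ^ i.2.2.1) (g ^ i.2.2.2) =
      ψ (g ^ i.1 : Fˣ) * ψ (g ^ i.2.1 : Fˣ) * (starRingEnd ℂ) (ψ (g ^ i.2.2.1 : Fˣ)) *
        (starRingEnd ℂ) (ψ (g ^ i.2.2.2 : Fˣ)) - (if g ^ i.1 = g ^ i.2.2.1 then 1 else 0) -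
          (if g ^ i.2.1 = g ^ i.2.2.1 then 1 else 0) + 1 / (Fintype.card Fˣ : ℂ) := by
    intro i hi
    have hi' := (Finset.mem_filter.1 hi).2
    rw [offDiagKernel, if_pos (by rw [← pow_add, ← pow_add, hi']),
      sub_eq_add_neg _ ((g ^ i.2.2.2 : Fˣ) : F), sub_eq_add_neg _ ((g ^ i.2.2.1 : Fˣ) : F),
      AddChar.map_add_eq_mul, AddChar.map_add_eq_mul, AddChar.map_add_eq_mul,
      AddChar.map_neg_eq_conj, AddChar.map_neg_eq_conj]
  rw [Finset.sum_congr rfl hK]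
  simp only [Finset.sum_add_distrib, Finset.sum_sub_distrib, Finset.sum_boole, Finset.sum_const,
    nsmul_eq_mul, hsymm]
  push_cast
  ring

/-! ### Counting additive quadruples -/

theorem card_pairs_sub_eq (s : ℕ) (h : ℤ) :
    {p ∈ Finset.range s ×ˢ Finset.range s | (p.1 : ℤ) - p.2 = h}.card = s - h.natAbs := by
  rw [← Finset.card_range (s - h.natAbs)]
  refine Finset.card_nbij' (fun p => min p.1 p.2) (fun j => (j + h.toNat, j + (-h).toNat))
    ?_ ?_ ?_ ?_
  · rintro ⟨a, b⟩
    simp only [Finset.coe_filter, Finset.mem_product, Finset.mem_range, Set.mem_ofPred_eq,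
      Finset.coe_range, Set.mem_Iio]
    omega
  · intro j
    simp only [Finset.coe_filter, Finset.mem_product, Finset.mem_range, Set.mem_ofPred_eq,
      Finset.coe_range, Set.mem_Iio]
    omega
  · rintro ⟨a, b⟩
    simp only [Finset.coe_filter, Finset.mem_product, Finset.mem_range, Set.mem_ofPred_eq,
      Prod.mk.injEq]
    omega
  · intro j
    simp only [Finset.coe_range, Set.mem_Iio]
    omega

/-- Sorting by `a - c = d - b = n N` leaves independent choices of `(a, c)` and `(d, b)`. The
subtraction in the sum is truncated, in accordance with `max 0 (s - |n| N)`. -/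
theorem card_additiveQuads_dvd {s N R : ℕ} (hN : 0 < N) (hR : s ≤ R * N) :
    {i ∈ additiveQuads s | (N : ℤ) ∣ i.1 - i.2.2.1}.card =
      ∑ n ∈ Finset.Icc (-R : ℤ) R, (s - n.natAbs * N) ^ 2 := by
  have hN' : (0 : ℤ) < N := by exact_mod_cast hN
  rw [Finset.card_eq_sum_card_fiberwise (f := fun i => ((i.1 : ℤ) - i.2.2.1) / N)
    (t := Finset.Icc (-R : ℤ) R)]
  · refine Finset.sum_congr rfl fun n _ => ?_
    have e : (s - n.natAbs * N) ^ 2 =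
        ({p ∈ Finset.range s ×ˢ Finset.range s | (p.1 : ℤ) - p.2 = n * N} ×ˢ
          {p ∈ Finset.range s ×ˢ Finset.range s | (p.1 : ℤ) - p.2 = n * N}).card := by
      rw [Finset.card_product, card_pairs_sub_eq, Int.natAbs_mul, Int.natAbs_natCast, sq]
    rw [e]
    refine Finset.card_nbij' (fun i => ((i.1, i.2.2.1), (i.2.2.2, i.2.1)))
      (fun p => (p.1.1, p.2.2, p.1.2, p.2.1)) ?_ ?_ (fun _ _ => rfl) (fun _ _ => rfl)
    · rintro ⟨a, b, c, d⟩
      simp only [additiveQuads, expQuads, Finset.coe_filter, Finset.mem_filter,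
        Finset.mem_product, Finset.mem_range, Set.mem_ofPred_eq, Finset.coe_product, Set.mem_prod]
      rintro ⟨⟨⟨hm, hsum⟩, ⟨k, hk⟩⟩, rfl⟩
      rw [hk, Int.mul_ediv_cancel_left _ hN'.ne', mul_comm k]
      omega
    · rintro ⟨⟨a, c⟩, d, b⟩
      simp only [additiveQuads, expQuads, Finset.coe_filter, Finset.mem_filter,
        Finset.mem_product, Finset.mem_range, Set.mem_ofPred_eq, Finset.coe_product, Set.mem_prod]
      rintro ⟨⟨⟨h1, h2⟩, h3⟩, ⟨h4, h5⟩, h6⟩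
      refine ⟨⟨⟨⟨h1, h5, h2, h4⟩, by omega⟩, ⟨n, by rw [h3, mul_comm]⟩⟩, ?_⟩
      rw [h3, Int.mul_ediv_cancel _ hN'.ne']
  · rintro ⟨a, b, c, d⟩
    simp only [additiveQuads, expQuads, Finset.coe_filter, Finset.mem_filter,
      Finset.mem_product, Finset.mem_range, Set.mem_ofPred_eq, Finset.coe_Icc, Set.mem_Icc]
    rintro ⟨⟨⟨h1, h2, h3, h4⟩, h5⟩, ⟨k, hk⟩⟩
    rw [hk, Int.mul_ediv_cancel_left _ hN'.ne']
    have hR' : (s : ℤ) ≤ R * N := by exact_mod_cast hR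
    constructor
    · by_contra! hlt
      nlinarith
    · by_contra! hlt
      nlinarith

theorem sum_Icc_neg_natAbs {M : Type*} [AddCommMonoid M] (φ : ℕ → M) (s : ℕ) :
    ∑ n ∈ Finset.Icc (-s : ℤ) s, φ n.natAbs = φ 0 + 2 • ∑ k ∈ Finset.range s, φ (k + 1) := by
  induction s with
  | zero => simp
  | succ s ih =>
    have e : Finset.Icc (-(s + 1 : ℕ) : ℤ) (s + 1 : ℕ) =
        insert (-(s + 1 : ℕ) : ℤ) (insert ((s + 1 : ℕ) : ℤ) (Finset.Icc (-s : ℤ) s)) := by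
      ext n
      simp only [Finset.mem_Icc, Finset.mem_insert]
      omega
    rw [e, Finset.sum_insert, Finset.sum_insert, ih, Finset.sum_range_succ, Int.natAbs_neg,
      Int.natAbs_natCast, smul_add, two_nsmul (φ (s + 1))]
    · abel
    · simp
    · simp only [Finset.mem_Icc, Finset.mem_insert]
      omega

theorem three_mul_card_additiveQuads (s : ℕ) : 3 * (additiveQuads s).card = 2 * s ^ 3 + s := by
  -- divisibility by `1` is no condition, so the count by residues applies with modulus `1`
  have h := card_additiveQuads_dvd (s := s) (R := s) one_pos (by omega)
  rw [Finset.filter_true_of_mem (fun i _ => by simp)] at h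
  simp only [mul_one] at h
  rw [h, sum_Icc_neg_natAbs (fun m => (s - m) ^ 2)]
  have hr : ∑ k ∈ Finset.range s, (s - (k + 1)) ^ 2 = ∑ k ∈ Finset.range s, k ^ 2 := by
    rw [← Finset.sum_range_reflect]
    refine Finset.sum_congr rfl fun k hk => ?_
    have := Finset.mem_range.1 hk
    congr 1
    omega
  have hsq : ∀ s : ℕ, 6 * (∑ k ∈ Finset.range s, k ^ 2) + 3 * s ^ 2 = 2 * s ^ 3 + s := by
    intro s
    induction s with
    | zero => simp
    | succ s ih =>
      rw [Finset.sum_range_succ]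
      nlinarith
  rw [hr, ← hsq, smul_eq_mul, Nat.sub_zero]
  ring

/-! ### The function `Ω` -/

theorem Omega_one_div_eq_sum {σ : ℝ} (hσ : 0 < σ) {R : ℕ} (hR : σ ≤ R) :
    Omega (1 / σ) 0 = ∑ n ∈ Finset.Icc (-R : ℤ) R, (max 0 (1 - n.natAbs / σ)) ^ 2 := by
  have habs : ∀ n : ℤ, |1 / σ * (n : ℝ) - 0| = n.natAbs / σ := by
    intro n
    rw [sub_zero, abs_mul, abs_of_pos (by positivity), Nat.cast_natAbs, Int.cast_abs]
    ring
  simp only [Omega, habs]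
  refine tsum_eq_sum fun n hn => ?_
  have hn' : R < n.natAbs := by
    rw [Finset.mem_Icc] at hn
    omega
  have : 1 ≤ (n.natAbs : ℝ) / σ := by
    rw [one_le_div hσ]
    exact hR.trans (by exact_mod_cast hn'.le)
  rw [max_eq_left (by linarith), zero_pow two_ne_zero]

/-! ### Asymptotics of the norm ratio -/

theorem tendsto_diag_div {I : Type*} {l : Filter I} {s N : I → ℕ} {σ : ℝ} (hσ : 0 < σ)
    (hN : Tendsto N l atTop) (hs : Tendsto (fun i => (s i : ℝ) / N i) l (𝓝 σ)) (R : ℕ) :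
    Tendsto (fun i => ((∑ n ∈ Finset.Icc (-R : ℤ) R, (s i - n.natAbs * N i) ^ 2 : ℕ) : ℝ) /
      (s i : ℝ) ^ 2) l (𝓝 (∑ n ∈ Finset.Icc (-R : ℤ) R, (max 0 (1 - n.natAbs / σ)) ^ 2)) := by
  have hlim : Tendsto (fun i => ∑ n ∈ Finset.Icc (-R : ℤ) R,
      (max 0 (1 - n.natAbs / ((s i : ℝ) / N i))) ^ 2) l
      (𝓝 (∑ n ∈ Finset.Icc (-R : ℤ) R, (max 0 (1 - n.natAbs / σ)) ^ 2)) :=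
    tendsto_finsetSum _ fun n _ =>
      (tendsto_const_nhds.max (tendsto_const_nhds.sub (tendsto_const_nhds.div hs hσ.ne'))).pow 2
  refine hlim.congr' ?_
  filter_upwards [hN.eventually_gt_atTop 0, hs.eventually_const_lt hσ] with i hNi hsi
  have hNi' : (0 : ℝ) < N i := by exact_mod_cast hNi
  have hsi' : (0 : ℝ) < s i := by
    have := mul_pos hsi hNi'
    rwa [div_mul_cancel₀ _ hNi'.ne'] at this
  push_cast
  rw [Finset.sum_div]
  refine Finset.sum_congr rfl fun n _ => ?_
  rw [← div_pow]
  congr 1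
  rw [eq_div_iff hsi'.ne', max_mul_of_nonneg _ _ hsi'.le, zero_mul]
  have e : (1 - (n.natAbs : ℝ) / ((s i : ℝ) / N i)) * s i = s i - (n.natAbs * N i : ℕ) := by
    push_cast
    field_simp
  rw [e]
  rcases le_total (s i) (n.natAbs * N i) with h | h
  · rw [Nat.sub_eq_zero_of_le h, Nat.cast_zero, max_eq_left]
    rw [sub_nonpos]
    exact_mod_cast h
  · rw [Nat.cast_sub h, max_eq_right]
    rw [sub_nonneg]
    exact_mod_cast h

theorem tendsto_card_additiveQuads_div {I : Type*} {l : Filter I} {s N : I → ℕ} {σ : ℝ}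
    (hσ : 0 < σ) (hN : Tendsto N l atTop) (hs : Tendsto (fun i => (s i : ℝ) / N i) l (𝓝 σ)) :
    Tendsto (fun i => ((additiveQuads (s i)).card : ℝ) / N i / (s i : ℝ) ^ 2) l
      (𝓝 (2 / 3 * σ)) := by
  have hN0 : Tendsto (fun i => ((N i : ℝ))⁻¹) l (𝓝 0) :=
    tendsto_inv_atTop_zero.comp (tendsto_natCast_atTop_atTop.comp hN)
  have hlim : Tendsto (fun i => 2 / 3 * ((s i : ℝ) / N i) +
      1 / 3 * ((s i : ℝ) / N i)⁻¹ * ((N i : ℝ)⁻¹) ^ 2) l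
      (𝓝 (2 / 3 * σ + 1 / 3 * σ⁻¹ * 0 ^ 2)) :=
    (hs.const_mul _).add (((hs.inv₀ hσ.ne').const_mul _).mul (hN0.pow 2))
  rw [zero_pow two_ne_zero, mul_zero, add_zero] at hlim
  refine hlim.congr' ?_
  filter_upwards [hN.eventually_gt_atTop 0, hs.eventually_const_lt hσ] with i hNi hsi
  have hNi' : (0 : ℝ) < N i := by exact_mod_cast hNi
  have hsi' : (0 : ℝ) < s i := by
    have := mul_pos hsi hNi'
    rwa [div_mul_cancel₀ _ hNi'.ne'] at this
  have h3 : 3 * ((additiveQuads (s i)).card : ℝ) = 2 * s i ^ 3 + s i := by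
    exact_mod_cast three_mul_card_additiveQuads (s i)
  have hc : ((additiveQuads (s i)).card : ℝ) = (2 * s i ^ 3 + s i) / 3 := by linarith
  rw [hc]
  field_simp

theorem tendsto_error_div {I : Type*} {l : Filter I} {s N : I → ℕ} {σ : ℝ}
    (hσ : 0 < σ) (hN : Tendsto N l atTop) (hs : Tendsto (fun i => (s i : ℝ) / N i) l (𝓝 σ)) :
    Tendsto (fun i => (2 * s i / N i + (1 + Real.log (N i))) ^ 4 *
      (3 * (((N i + 1 : ℕ) : ℝ) * √((N i + 1 : ℕ) : ℝ))) / (s i : ℝ) ^ 2) l (𝓝 0) := by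
  have hNr : Tendsto (fun i => (N i : ℝ)) l atTop := tendsto_natCast_atTop_atTop.comp hN
  -- the saving of `√N` over `N ^ 2` is distributed as `N ^ (1 / 8)` to each of the four factors
  have hpow : Tendsto (fun i => ((N i : ℝ) ^ (1 / 8 : ℝ))⁻¹) l (𝓝 0) :=
    tendsto_inv_atTop_zero.comp ((tendsto_rpow_atTop (by norm_num)).comp hNr)
  have hlog : Tendsto (fun i => Real.log (N i) / (N i : ℝ) ^ (1 / 8 : ℝ)) l (𝓝 0) :=
    (isLittleO_log_rpow_atTop (by norm_num : (0 : ℝ) < 1 / 8)).tendsto_div_nhds_zero.comp hNr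
  have hlim : Tendsto (fun i => 12 * ((s i : ℝ) / N i)⁻¹ ^ 2 *
      ((2 * ((s i : ℝ) / N i) + 1) * ((N i : ℝ) ^ (1 / 8 : ℝ))⁻¹ +
        Real.log (N i) / (N i : ℝ) ^ (1 / 8 : ℝ)) ^ 4) l
      (𝓝 (12 * σ⁻¹ ^ 2 * ((2 * σ + 1) * 0 + 0) ^ 4)) :=
    (((hs.inv₀ hσ.ne').pow 2).const_mul _).mul
      (((((hs.const_mul _).add tendsto_const_nhds).mul hpow).add hlog).pow 4)
  rw [mul_zero, add_zero, zero_pow four_ne_zero, mul_zero] at hlim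
  refine tendsto_of_tendsto_of_tendsto_of_le_of_le' tendsto_const_nhds hlim ?_ ?_
  · filter_upwards with i
    positivity
  filter_upwards [hN.eventually_gt_atTop 0, hs.eventually_const_lt hσ] with i hNi hsi
  have hNi' : (0 : ℝ) < N i := by exact_mod_cast hNi
  have hN1 : (1 : ℝ) ≤ N i := by exact_mod_cast hNi
  have hsi' : (0 : ℝ) < s i := by
    have := mul_pos hsi hNi'
    rwa [div_mul_cancel₀ _ hNi'.ne'] at this
  have hroot : √((N i + 1 : ℕ) : ℝ) ≤ 2 * √(N i) := by
    rw [Real.sqrt_le_left (by positivity), mul_pow, Real.sq_sqrt hNi'.le]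
    push_cast
    linarith
  have h8 : ((N i : ℝ) ^ (1 / 8 : ℝ)) ^ 4 = √(N i) := by
    rw [← Real.rpow_natCast, ← Real.rpow_mul hNi'.le, Real.sqrt_eq_rpow]
    norm_num
  have hs2 : √(N i : ℝ) ^ 2 = N i := Real.sq_sqrt hNi'.le
  have hpos8 : 0 < (N i : ℝ) ^ (1 / 8 : ℝ) := by positivity
  calc (2 * s i / N i + (1 + Real.log (N i))) ^ 4 *
        (3 * (((N i + 1 : ℕ) : ℝ) * √((N i + 1 : ℕ) : ℝ))) / (s i : ℝ) ^ 2
      ≤ (2 * s i / N i + (1 + Real.log (N i))) ^ 4 *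
        (3 * ((2 * N i) * (2 * √(N i)))) / (s i : ℝ) ^ 2 := by
        gcongr
        push_cast
        linarith
    _ = 12 * ((s i : ℝ) / N i)⁻¹ ^ 2 * (2 * s i / N i + (1 + Real.log (N i))) ^ 4 *
          (√(N i) / N i) := by
        field_simp
        ring
    _ = 12 * ((s i : ℝ) / N i)⁻¹ ^ 2 * (2 * s i / N i + (1 + Real.log (N i))) ^ 4 *
          (1 / ((N i : ℝ) ^ (1 / 8 : ℝ)) ^ 4) := by
        congr 1
        rw [h8, div_eq_div_iff hNi'.ne' (by positivity), one_mul, ← sq, hs2]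
    _ = _ := by
        rw [mul_assoc, one_div, ← inv_pow, ← mul_pow]
        congr 2
        field_simp
        ring

/-- The translation only replaces `ψ` by another nontrivial additive character. -/
theorem AddCharPoly.exists_toPolynomial_eq {F : Type v} [Field F] [Finite F] (f : AddCharPoly F) :
    ∃ (ψ : AddChar F ℂ) (g : Fˣ), ψ ≠ 1 ∧ (∀ x, x ∈ Subgroup.zpowers g) ∧
      f.toPolynomial = ∑ j ∈ Finset.range f.size,
        Polynomial.C (ψ (g ^ j : Fˣ)) * Polynomial.X ^ j := by
  set u : Fˣ := f.arrangement (Multiplicative.ofAdd f.translation)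
  refine ⟨f.char.mulShift u, f.arrangement (Multiplicative.ofAdd 1),
    AddChar.IsPrimitive.of_ne_one f.char_nontrivial u.ne_zero, fun x => ?_, ?_⟩
  · obtain ⟨n, rfl⟩ := f.arrangement_surjective x
    refine Subgroup.mem_zpowers_iff.2 ⟨n.toAdd, ?_⟩
    rw [← map_zpow, ← ofAdd_zsmul, smul_eq_mul, mul_one, ofAdd_toAdd]
  · refine Finset.sum_congr rfl fun j _ => ?_
    rw [AddChar.mulShift_apply, ← Units.val_mul, ← map_pow, ← ofAdd_nsmul, ofAdd_add, map_mul,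
      nsmul_one, mul_comm (u : Fˣ)]

theorem AddCharPoly.lrNorm_two_pow_four {F : Type v} [Field F] [Finite F] (f : AddCharPoly F) :
    lrNorm 2 f.toPolynomial ^ 4 = (f.size : ℝ) ^ 2 := by
  obtain ⟨ψ, g, -, -, hf⟩ := f.exists_toPolynomial_eq
  rw [hf, show (4 : ℕ) = 2 * 2 from rfl, pow_mul,
    lrNorm_two_sq (fun j => ψ (g ^ j : Fˣ)) fun j => AddChar.norm_apply _ _]

theorem AddCharPoly.abs_lrNorm_four_sub_le {F : Type v} [Field F] [Finite F] (f : AddCharPoly F)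
    {N R : ℕ} (hN : Nat.card F = N + 1) (hR : f.size ≤ R * N) :
    |lrNorm 4 f.toPolynomial ^ 4 -
      (2 * ((∑ n ∈ Finset.Icc (-R : ℤ) R, (f.size - n.natAbs * N) ^ 2 : ℕ) : ℝ) -
        ((additiveQuads f.size).card : ℝ) / N)| ≤
      (2 * f.size / N + (1 + Real.log N)) ^ 4 *
        (3 * (((N + 1 : ℕ) : ℝ) * √((N + 1 : ℕ) : ℝ))) := by
  classical
  have := Fintype.ofFinite F
  obtain ⟨ψ, g, hψ, hg, hf⟩ := f.exists_toPolynomial_eq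
  have hF : Fintype.card F = N + 1 := by rw [← hN, Nat.card_eq_fintype_card]
  have hFu : Fintype.card Fˣ = N := by rw [Fintype.card_units, hF, Nat.add_sub_cancel]
  have hN0 : 0 < N := hFu ▸ Fintype.card_pos
  have h := _root_.abs_lrNorm_four_sub_le hψ hg f.size
  have hdvd : ∀ i ∈ additiveQuads f.size, g ^ i.1 = g ^ i.2.2.1 ↔ (N : ℤ) ∣ i.1 - i.2.2.1 := by
    intro i _
    rw [pow_eq_pow_iff_modEq, orderOf_eq_card_of_forall_mem_zpowers hg, Nat.card_eq_fintype_card,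
      hFu, Nat.ModEq.comm, Nat.modEq_iff_dvd]
  rw [Finset.filter_congr hdvd, card_additiveQuads_dvd hN0 hR, hFu, hF] at h
  rw [hf]
  exact h

theorem tendsto_normRatio {I : Type u} {F : I → Type v} [∀ i, Field (F i)] [∀ i, Finite (F i)]
    (f : ∀ i, AddCharPoly (F i)) {σ : ℝ} (hσ : 0 < σ)
    (hf : Tendsto (fun i => ((f i).support.card : ℝ) / ((Nat.card (F i) : ℝ) - 1))
      (orderAtTop F) (𝓝 σ)) :
    Tendsto (fun i => (f i).normRatio) (orderAtTop F) (𝓝 (limitRatio σ)) := by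
  set N : I → ℕ := fun i => Nat.card (F i) - 1 with hNdef
  set s : I → ℕ := fun i => (f i).size with hsdef
  have hN1 : ∀ i, Nat.card (F i) = N i + 1 := fun i => (Nat.sub_add_cancel Nat.card_pos).symm
  have hN : Tendsto N (orderAtTop F) atTop := (tendsto_sub_atTop_nat 1).comp tendsto_comap
  have hs : Tendsto (fun i => (s i : ℝ) / N i) (orderAtTop F) (𝓝 σ) := by
    refine hf.congr fun i => ?_
    rw [hN1, AddCharPoly.support, Finset.card_range]
    push_cast
    rw [add_sub_cancel_right]
  obtain ⟨R, hR⟩ := exists_nat_gt σ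
  have hmain := ((tendsto_diag_div hσ hN hs R).const_mul 2).sub
    (tendsto_card_additiveQuads_div hσ hN hs)
  have hval : 2 * ∑ n ∈ Finset.Icc (-R : ℤ) R, (max 0 (1 - n.natAbs / σ)) ^ 2 - 2 / 3 * σ =
      limitRatio σ := by
    rw [limitRatio, Omega_one_div_eq_sum hσ hR.le]
    ring
  rw [hval] at hmain
  refine hmain.congr_dist ?_
  refine squeeze_zero' (Eventually.of_forall fun _ => dist_nonneg) ?_ (tendsto_error_div hσ hN hs)
  filter_upwards [hN.eventually_gt_atTop 0, hs.eventually_const_lt hσ,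
    hs.eventually_lt_const hR] with i hNi hsi hRi
  have hNi' : (0 : ℝ) < N i := by exact_mod_cast hNi
  have hsi' : (0 : ℝ) < s i := by
    have := mul_pos hsi hNi'
    rwa [div_mul_cancel₀ _ hNi'.ne'] at this
  have hsR : s i ≤ R * N i := by
    rw [div_lt_iff₀ hNi'] at hRi
    exact_mod_cast hRi.le
  have h := (f i).abs_lrNorm_four_sub_le (hN1 i) hsR
  rw [dist_comm, Real.dist_eq, AddCharPoly.normRatio, AddCharPoly.lrNorm_two_pow_four,
    mul_div_assoc', ← sub_div, ← sub_div, abs_div, abs_of_pos (by positivity : 0 < (s i : ℝ) ^ 2)]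
  gcongr

theorem orderAtTop_neBot {I : Type u} {F : I → Type v}
    (h : (Set.range fun i => Nat.card (F i)).Infinite) : (orderAtTop F).NeBot := by
  refine comap_neBot fun t ht => ?_
  obtain ⟨n, hn⟩ := mem_atTop_sets.1 ht
  obtain ⟨_, ⟨i, rfl⟩, hi⟩ := h.exists_gt n
  exact ⟨i, hn _ hi.le⟩

/-! ### Minimizing the limit -/

theorem limitRatio_of_le_one {x : ℝ} (h0 : 0 < x) (h1 : x ≤ 1) :
    limitRatio x = 2 - 2 / 3 * x := by
  have h : 1 - 1 / x ≤ 0 := by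
    rw [sub_nonpos, le_div_iff₀ h0]
    linarith
  rw [limitRatio, Omega_one_div_eq_sum h0 (R := 1) (by exact_mod_cast h1),
    sum_Icc_neg_natAbs (fun m => (max 0 (1 - m / x)) ^ 2)]
  simp only [Finset.sum_range_one, zero_add, Nat.cast_one, Nat.cast_zero, zero_div, sub_zero]
  rw [max_eq_left h, max_eq_right zero_le_one]
  norm_num
  ring

theorem limitRatio_of_mem_Icc {x : ℝ} (h1 : 1 ≤ x) (h2 : x ≤ 2) :
    limitRatio x = -(2 / 3) * x + 6 - 8 / x + 4 / x ^ 2 := by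
  have h0 : 0 < x := by linarith
  have h : 0 ≤ 1 - 1 / x := by
    rw [sub_nonneg, div_le_iff₀ h0]
    linarith
  have h' : 1 - 2 / x ≤ 0 := by
    rw [sub_nonpos, le_div_iff₀ h0]
    linarith
  rw [limitRatio, Omega_one_div_eq_sum h0 (R := 2) (by exact_mod_cast h2),
    sum_Icc_neg_natAbs (fun m => (max 0 (1 - m / x)) ^ 2)]
  simp only [Finset.sum_range_succ, Finset.sum_range_zero, zero_add, Nat.cast_add, Nat.cast_one,
    Nat.cast_zero, zero_div, sub_zero, one_add_one_eq_two]
  rw [max_eq_right h, max_eq_left h', max_eq_right zero_le_one, two_nsmul]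
  field_simp
  ring

/-- For a convex summand the trapezoid rule overestimates the integral, which gives
`Ω (1 / x, 0) ≥ 2 x / 3`. -/
theorem two_thirds_mul_le_limitRatio {x : ℝ} (h0 : 0 < x) : 2 / 3 * x ≤ limitRatio x := by
  set m := ⌊x⌋₊ with hm
  have hmx : (m : ℝ) ≤ x := Nat.floor_le h0.le
  have hxm : x < m + 1 := Nat.lt_floor_add_one x
  have hm0 : (0 : ℝ) ≤ m := m.cast_nonneg
  have hsum : ∀ m : ℕ, ∑ k ∈ Finset.range m, (1 - ((k + 1 : ℕ) : ℝ) / x) ^ 2 =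
      m - m * (m + 1) / x + m * (m + 1) * (2 * m + 1) / (6 * x ^ 2) := by
    intro m
    induction m with
    | zero => simp
    | succ m ih =>
      rw [Finset.sum_range_succ, ih]
      push_cast
      field_simp
      ring
  have hΩ : 1 + 2 * (m - m * (m + 1) / x + m * (m + 1) * (2 * m + 1) / (6 * x ^ 2)) ≤
      Omega (1 / x) 0 := by
    rw [Omega_one_div_eq_sum h0 (R := m + 1) (by push_cast; exact hxm.le),
      sum_Icc_neg_natAbs (fun m => (max 0 (1 - m / x)) ^ 2), Finset.sum_range_succ, ← hsum]
    have e : ∑ k ∈ Finset.range m, (max 0 (1 - ((k + 1 : ℕ) : ℝ) / x)) ^ 2 =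
        ∑ k ∈ Finset.range m, (1 - ((k + 1 : ℕ) : ℝ) / x) ^ 2 := by
      refine Finset.sum_congr rfl fun k hk => ?_
      rw [max_eq_right]
      rw [sub_nonneg, div_le_one h0]
      have : ((k + 1 : ℕ) : ℝ) ≤ m := by exact_mod_cast Finset.mem_range.1 hk
      linarith
    rw [e, Nat.cast_zero, zero_div, sub_zero, max_eq_right zero_le_one, two_nsmul]
    nlinarith [sq_nonneg (max 0 (1 - ((m + 1 : ℕ) : ℝ) / x))]
  have hpoly : 2 / 3 * x ≤ 1 + 2 * (m - m * (m + 1) / x + m * (m + 1) * (2 * m + 1) / (6 * x ^ 2)) := by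
    rw [← sub_nonneg]
    have e : 1 + 2 * (m - m * (m + 1) / x + m * (m + 1) * (2 * m + 1) / (6 * x ^ 2)) - 2 / 3 * x =
        (m / 3 + (x - m) ^ 2 * (1 - 2 / 3 * (x - m))) / x ^ 2 := by
      field_simp
      ring
    rw [e]
    have : 0 ≤ 1 - 2 / 3 * (x - m) := by linarith
    positivity
  rw [limitRatio]
  linarith

theorem limitRatio_lt_of_root {a : ℝ} (ha1 : 1 < a) (ha2 : a < 1 + 9 / 64)
    (ha : a ^ 3 - 12 * a + 12 = 0) {x : ℝ} (hx : 0 < x) (hxa : x ≠ a) :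
    limitRatio a < limitRatio x := by
  have hmid : ∀ y, 1 ≤ y → y ≤ 2 → y ≠ a → limitRatio a < limitRatio y := by
    intro y h1 h2 hne
    have h0 : 0 < y := by linarith
    have ha0 : 0 < a := by linarith
    rw [limitRatio_of_mem_Icc h1 h2, limitRatio_of_mem_Icc ha1.le (by linarith), ← sub_pos]
    -- the derivative vanishes at `a`, so the difference has the double factor `(y - a) ^ 2`
    have e : -(2 / 3) * y + 6 - 8 / y + 4 / y ^ 2 - (-(2 / 3) * a + 6 - 8 / a + 4 / a ^ 2) =
        (y - a) ^ 2 * (8 * a - 4 - 2 / 3 * a ^ 2 * (y + a)) / (y ^ 2 * a ^ 2) := by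
      field_simp
      linear_combination (2 * a * (a - y)) * ha
    rw [e]
    have hsq : 0 < (y - a) ^ 2 := by
      have := sub_ne_zero.2 hne
      positivity
    have ha2' : a ^ 2 ≤ 1.31 := by nlinarith
    have : 0 < 8 * a - 4 - 2 / 3 * a ^ 2 * (y + a) := by nlinarith
    positivity
  have hone : limitRatio a < 4 / 3 := by
    have := hmid 1 le_rfl one_le_two ha1.ne
    rw [limitRatio_of_le_one one_pos le_rfl] at this
    linarith
  rcases le_total x 1 with h | h
  · rw [limitRatio_of_le_one hx h]
    linarith
  rcases le_total x 2 with h' | h'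
  · exact hmid x h h' hxa
  · have := two_thirds_mul_le_limitRatio hx
    linarith

theorem existsUnique_root :
    ∃! x : ℝ, x ∈ Set.Ioo (1 : ℝ) (1 + 9 / 64) ∧ x ^ 3 - 12 * x + 12 = 0 := by
  have hc : ContinuousOn (fun x : ℝ => x ^ 3 - 12 * x + 12) (Set.Icc 1 (1 + 9 / 64)) := by fun_prop
  have hm : (0 : ℝ) ∈ Set.Ioo ((1 + 9 / 64 : ℝ) ^ 3 - 12 * (1 + 9 / 64) + 12)
      ((1 : ℝ) ^ 3 - 12 * 1 + 12) := by
    constructor <;> norm_num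
  obtain ⟨a, ha, h⟩ := intermediate_value_Ioo' (by norm_num) hc hm
  refine ⟨a, ⟨ha, h⟩, fun b ⟨hb, hb'⟩ => ?_⟩
  have hf : (b - a) * (b ^ 2 + a * b + a ^ 2 - 12) = 0 := by
    simp only at h
    linear_combination hb' - h
  rcases mul_eq_zero.1 hf with h' | h'
  · linarith
  · obtain ⟨ha1, ha2⟩ := ha
    obtain ⟨hb1, hb2⟩ := hb
    nlinarith

theorem isMinOn_limitRatio_iff {σ : ℝ} (hσ : 0 < σ) : IsMinOn limitRatio (Set.Ioi 0) σ ↔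
    σ ∈ Set.Ioo (1 : ℝ) (1 + 9 / 64) ∧ σ ^ 3 - 12 * σ + 12 = 0 := by
  constructor
  · intro h
    obtain ⟨a, ⟨⟨ha1, ha2⟩, ha⟩, -⟩ := existsUnique_root
    by_contra hne
    have hlt := limitRatio_lt_of_root ha1 ha2 ha hσ (by rintro rfl; exact hne ⟨⟨ha1, ha2⟩, ha⟩)
    exact (isMinOn_iff.1 h a (Set.mem_Ioi.2 (by linarith))).not_gt hlt
  · rintro ⟨⟨h1, h2⟩, h⟩
    refine isMinOn_iff.2 fun x hx => ?_
    rcases eq_or_ne x σ with rfl | hne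
    · exact le_rfl
    · exact (limitRatio_lt_of_root h1 h2 h hx hne).le

/-- Any size-stable family can be resized to any other limiting size. -/
theorem isSizeStable_resize {I : Type u} {F : I → Type v} [∀ i, Field (F i)] [∀ i, Finite (F i)]
    (f : ∀ i, AddCharPoly (F i)) (h : (Set.range fun i => Nat.card (F i)).Infinite) {τ : ℝ}
    (hτ : 0 < τ) :
    IsSizeStable (fun i => { f i with size := ⌊τ * ((Nat.card (F i) : ℝ) - 1)⌋₊ }) τ := by
  refine ⟨h, hτ, ?_⟩
  have ht : Tendsto (fun i => (Nat.card (F i) : ℝ) - 1) (orderAtTop F) atTop :=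
    tendsto_atTop_add_const_right _ (-1)
      (tendsto_natCast_atTop_atTop.comp (tendsto_comap (f := fun i => Nat.card (F i))))
  simp only [AddCharPoly.support, Finset.card_range]
  exact (tendsto_nat_floor_mul_div_atTop hτ.le).comp ht

theorem theorem3 {I : Type u} {F : I → Type v} [∀ i, Field (F i)] [∀ i, Finite (F i)]
    (f : ∀ i, AddCharPoly (F i)) (σ : ℝ) (hf : IsSizeStable f σ) :
    -- part (i): the limit of the ratio of norms
    Tendsto (fun i => (f i).normRatio) (orderAtTop F) (𝓝 (-(2 / 3) * σ + 2 * Omega (1 / σ) 0)) ∧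
    -- part (ii): the cubic has exactly one root in the interval
    (∃! x : ℝ, x ∈ Set.Ioo (1 : ℝ) (1 + 9 / 64) ∧ x ^ 3 - 12 * x + 12 = 0) ∧
    -- the limit is minimal among the values at all positive real sizes iff `σ` is that root
    (IsMinOn limitRatio (Set.Ioi 0) σ ↔
      σ ∈ Set.Ioo (1 : ℝ) (1 + 9 / 64) ∧ σ ^ 3 - 12 * σ + 12 = 0) ∧
    -- the limit is minimal among the limits of all size-stable families iff `σ` is that root
    ((∀ (J : Type u) (G : J → Type v) [∀ j, Field (G j)] [∀ j, Finite (G j)]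
        (g : ∀ j, AddCharPoly (G j)) (τ ℓ : ℝ), IsSizeStable g τ →
        Tendsto (fun j => (g j).normRatio) (orderAtTop G) (𝓝 ℓ) → limitRatio σ ≤ ℓ) ↔
      σ ∈ Set.Ioo (1 : ℝ) (1 + 9 / 64) ∧ σ ^ 3 - 12 * σ + 12 = 0) := by
  obtain ⟨hinf, hσ, hlim⟩ := hf
  refine ⟨tendsto_normRatio f hσ hlim, existsUnique_root, isMinOn_limitRatio_iff hσ, ?_⟩
  rw [← isMinOn_limitRatio_iff hσ, isMinOn_iff]
  constructor
  · intro h τ hτ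
    have hres := isSizeStable_resize f hinf (Set.mem_Ioi.1 hτ)
    exact h I F _ τ _ hres (tendsto_normRatio _ hτ hres.2.2)
  · intro h J G _ _ g τ ℓ hg hℓ
    have := orderAtTop_neBot hg.1
    rw [tendsto_nhds_unique hℓ (tendsto_normRatio g hg.2.1 hg.2.2)]
    exact h τ (Set.mem_Ioi.2 hg.2.1)
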